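/- Let $P$ be a finite set of $n$ distinct points in the plane $\mathbb{C}$. Assume that $P$ is a hull configuration, i.e. its convex hull $\mathrm{Conv}(P)$ is either one-dimensional or contains no element of $P$ in its interior. Assume also that $\mathrm{Conv}(P)$ is one-dimensional (a segment) or that it has at least one blank side, i.e. a side (edge) $[x,y]$ whose only points in $P$ are its two endpoints $x \neq y$. Let $\mathrm{NC}(P)$ be the set of noncrossing partitions of $P$, that is, of set partitions of $P$ whose blocks have pairwise disjoint convex hulls, partially ordered by refinement, with rank $\mathrm{rk}(\pi) = n - (\text{number of blocks of } \pi)$. Then $\mathrm{NC}(P)$ has a symmetric chain decomposition: it is the disjoint union of chains $\pi_1 < \cdots < \pi_m$ that are saturated (each $\pi_{i+1}$ covers $\pi_i$ in $\mathrm{NC}(P)$) and centered (for each $0 \le k \le n-1$, the chain has equally many elements of rank $k$ and of rank $n-1-k$). -/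

import Mathlib

noncomputable section

namespace HullConfig

/-- The convex hull `Conv(P)` of a finite configuration `P` of distinct points in the plane `ℂ`. -/
abbrev Conv (P : Finset ℂ) : Set ℂ := convexHull ℝ (P : Set ℂ)

/-- `Conv(P)` is one-dimensional, i.e. `P` consists of at least two points, all on a common line. -/
def IsOneDimensional (P : Finset ℂ) : Prop :=
  Module.finrank ℝ (vectorSpan ℝ (Conv P)) = 1

/-- `P` is a hull configuration: `Conv(P)` is either one-dimensional or contains no elements of `P`
in its interior. -/
def IsHullConfiguration (P : Finset ℂ) : Prop :=
  IsOneDimensional P ∨ ∀ z ∈ P, z ∉ interior (Conv P)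

/-- `Conv(P)` has a blank side: there are distinct points `x, y` of `P` such that the segment
`[x, y]` is a side (a one-dimensional exposed face) of `Conv(P)` and contains no points of `P`
other than its endpoints. -/
def HasBlankSide (P : Finset ℂ) : Prop :=
  ∃ x ∈ P, ∃ y ∈ P, x ≠ y ∧ IsExposed ℝ (Conv P) (segment ℝ x y) ∧
    ∀ z ∈ P, z ∈ segment ℝ x y → z = x ∨ z = y

/-- A set partition of `P` is noncrossing if the convex hulls of its blocks are pairwise
disjoint. -/
def IsNoncrossing {P : Finset ℂ} (π : Finpartition P) : Prop :=
  (π.parts : Set (Finset ℂ)).PairwiseDisjoint Conv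

/-- The poset `NC(P)` of noncrossing partitions of `P`, ordered by refinement
(the order of `Finpartition`). -/
abbrev NC (P : Finset ℂ) : Type := {π : Finpartition P // IsNoncrossing π}

/-- The rank of a noncrossing partition: number of points minus number of blocks. -/
def rk {P : Finset ℂ} (π : NC P) : ℕ := P.card - π.1.parts.card

/-- A set of noncrossing partitions is centered if it has equally many elements of rank `k` and of
rank `l` whenever `k + l = n - 1`, where `n` is the number of points; the ranks in `NC(P)` run from
`0` to `n - 1`. -/
def IsCentered {P : Finset ℂ} (S : Set (NC P)) : Prop :=
  ∀ k l : ℕ, k + l + 1 = P.card → {π ∈ S | rk π = k}.ncard = {π ∈ S | rk π = l}.ncard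

/-- A saturated chain: the set of entries of a sequence `π₁, …, πₖ` each of whose entries is
covered by the next one. -/
def IsSaturatedChain {α : Type*} [PartialOrder α] (S : Set α) : Prop :=
  ∃ l : List α, l.IsChain (· ⋖ ·) ∧ S = {x | x ∈ l}

/-- `NC(P)` is the disjoint union of (nonempty) centered saturated chains. -/
def HasSymmetricChainDecomposition (P : Finset ℂ) : Prop :=
  ∃ C : Set (Set (NC P)), Setoid.IsPartition C ∧ ∀ S ∈ C, IsSaturatedChain S ∧ IsCentered S

end HullConfig

end

/-!
The points of `P` are put in *weakly convex position*: they are ordered, starting at one end of the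
blank side and going around the hull to its other end, so that every triple `i < j < k` is either
positively oriented or collinear with `j` in the segment from `i` to `k`
(`exists_order_of_blank_side`; in the one-dimensional case any linear coordinate will do). Blankness
of the side that joins the last point to the first keeps collinear triples in linear order. The
condition passes to all subfamilies, which is what makes an induction possible.

In weakly convex position, two disjoint blocks have disjoint hulls if and only if their points do
not alternate and no point of one is collinear with two points of the other and lies between them
(`WeaklyConvex.disjoint_convexHull`, `WeaklyConvex.segment_inter`). So noncrossing partitions
become certain equivalence relations on a finite linear order (`NCOn`, `blockRel_mem_NCOn_iff`), and
partitions of subsets are treated as relations that are trivial elsewhere.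

These relations are decomposed as in the argument of Simion and Ullman for the classical lattice of
noncrossing partitions. Let `x` be the least of `n` points and `k` the successor of `x` in its
block. If `x` is isolated, or if `k` is the second point, the rest of the partition is an arbitrary
noncrossing partition of the other `n - 1` points; the two families form a product of this poset
with a chain of length one. For any other `k`, either the points between `x` and `k` are collinear
with them and no such partition exists, or the partition amounts to a pair of noncrossing partitions
of the points between `x` and `k` and of the points from `k` on, with ranks shifted by one
(`nextSet_eq_image2`). All pieces are centered at the rank `(n - 1) / 2`, and a product of symmetric
chains is a union of symmetric chains (`HasSymmChains.image2`), so `hasSymmChains_NCOn` follows by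
induction. As the rank is strictly monotone, chains whose ranks increase by one are saturated.
-/

namespace HullConfig
open Set

/-! ### Symmetric chains in a ranked poset -/

section Chains

variable {X Y Z : Type*} [PartialOrder X] [PartialOrder Y] [PartialOrder Z]

/-- The set `c` consists of the entries of a strictly increasing sequence `f 0 < ⋯ < f m` along
which `rank` increases by one at each step, starting at a value `s` with `s + (s + m) = N`. For a
strictly monotone `rank`, such a sequence is automatically saturated. -/
def IsSymmChain (rank : X → ℕ) (N : ℕ) (c : Set X) : Prop :=
  ∃ (m s : ℕ) (f : ℕ → X), 2 * s + m = N ∧ (∀ j ≤ m, rank (f j) = s + j) ∧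
    (∀ j < m, f j < f (j + 1)) ∧ c = f '' Iic m

/-- The set `S` is a disjoint union of symmetric chains. -/
def HasSymmChains (rank : X → ℕ) (N : ℕ) (S : Set X) : Prop :=
  ∃ C : Set (Set X), (∀ c ∈ C, IsSymmChain rank N c) ∧ C.PairwiseDisjoint id ∧ ⋃₀ C = S

lemma IsSymmChain.nonempty {rank : X → ℕ} {N : ℕ} {c : Set X} (h : IsSymmChain rank N c) :
    c.Nonempty := by
  obtain ⟨m, s, f, -, -, -, rfl⟩ := h
  exact ⟨f 0, 0, Nat.zero_le _, rfl⟩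

lemma IsSymmChain.hasSymmChains {rank : X → ℕ} {N : ℕ} {c : Set X} (h : IsSymmChain rank N c) :
    HasSymmChains rank N c :=
  ⟨{c}, by simpa using h, by simp, by simp⟩

lemma HasSymmChains.empty (rank : X → ℕ) (N : ℕ) : HasSymmChains rank N (∅ : Set X) :=
  ⟨∅, by simp, by simp, by simp⟩

lemma HasSymmChains.iUnion {rank : X → ℕ} {N : ℕ} {ι : Type*} {S : ι → Set X}
    (hS : ∀ i, HasSymmChains rank N (S i)) (hd : Pairwise fun i j => Disjoint (S i) (S j)) :
    HasSymmChains rank N (⋃ i, S i) := by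
  choose C hC hCd hCu using hS
  refine ⟨⋃ i, C i, ?_, ?_, ?_⟩
  · intro c hc
    obtain ⟨i, hi⟩ := mem_iUnion.1 hc
    exact hC i c hi
  · intro c hc d hd' hne
    obtain ⟨i, hi⟩ := mem_iUnion.1 hc
    obtain ⟨j, hj⟩ := mem_iUnion.1 hd'
    by_cases hij : i = j
    · subst hij
      exact hCd i hi hj hne
    · refine (hd hij).mono ?_ ?_
      · rw [← hCu i]; exact subset_sUnion_of_mem hi
      · rw [← hCu j]; exact subset_sUnion_of_mem hj
  · rw [sUnion_iUnion]
    exact iUnion_congr hCu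

lemma HasSymmChains.union {rank : X → ℕ} {N : ℕ} {S T : Set X} (hS : HasSymmChains rank N S)
    (hT : HasSymmChains rank N T) (hd : Disjoint S T) : HasSymmChains rank N (S ∪ T) := by
  have : S ∪ T = ⋃ b : Bool, cond b S T := by
    ext x; simp [or_comm]
  rw [this]
  refine HasSymmChains.iUnion (by rintro (_ | _) <;> assumption) ?_
  rintro (_ | _) (_ | _) h
  · exact (h rfl).elim
  · exact hd.symm
  · exact hd
  · exact (h rfl).elim

/-- A product of two chains, embedded by `g`, is a disjoint union of symmetric chains: the bottom
row followed by the last column is one, and the remaining points form a smaller grid. -/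
lemma hasSymmChains_grid {rank : X → ℕ} {N : ℕ} (m n s : ℕ) (g : ℕ → ℕ → X)
    (hN : 2 * s + m + n = N)
    (hrank : ∀ i ≤ m, ∀ j ≤ n, rank (g i j) = s + i + j)
    (hfst : ∀ i < m, ∀ j ≤ n, g i j < g (i + 1) j)
    (hsnd : ∀ i ≤ m, ∀ j < n, g i j < g i (j + 1))
    (hinj : ∀ i ≤ m, ∀ j ≤ n, ∀ i' ≤ m, ∀ j' ≤ n, g i j = g i' j' → i = i' ∧ j = j') :
    HasSymmChains rank N {x | ∃ i ≤ m, ∃ j ≤ n, g i j = x} := by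
  induction m generalizing n s g with
  | zero =>
    refine IsSymmChain.hasSymmChains ⟨n, s, g 0, by omega, ?_, ?_, ?_⟩
    · intro j hj
      simpa using hrank 0 le_rfl j hj
    · exact hsnd 0 le_rfl
    · ext x; simp
  | succ m ih =>
    let f : ℕ → X := fun j => if j ≤ m + 1 then g j 0 else g (m + 1) (j - (m + 1))
    have hchain : IsSymmChain rank N (f '' Iic (m + 1 + n)) := by
      refine ⟨m + 1 + n, s, f, by omega, ?_, ?_, rfl⟩
      · intro j hj
        by_cases h : j ≤ m + 1
        · simp only [f, if_pos h]
          simpa using hrank j h 0 (Nat.zero_le _)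
        · simp only [f, if_neg h]
          rw [hrank _ le_rfl _ (by omega)]; omega
      · intro j hj
        rcases lt_trichotomy j (m + 1) with h | h | h
        · simp only [f, if_pos h.le, if_pos (Nat.succ_le_of_lt h)]
          exact hfst j h 0 (Nat.zero_le _)
        · subst h
          simp only [f, le_refl, if_true, if_neg (Nat.not_succ_le_self _)]
          simpa using hsnd (m + 1) le_rfl 0 (by omega)
        · simp only [f, if_neg (not_le.2 h), if_neg (not_le.2 (h.trans (Nat.lt_succ_self _)))]
          have := hsnd (m + 1) le_rfl (j - (m + 1)) (by omega)
          rwa [show j - (m + 1) + 1 = j + 1 - (m + 1) by omega] at this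
    have hf : f '' Iic (m + 1 + n) =
        {x | ∃ i ≤ m + 1, ∃ j ≤ n, (j = 0 ∨ i = m + 1) ∧ g i j = x} := by
      ext x
      constructor
      · rintro ⟨j, hj, rfl⟩
        have hj : j ≤ m + 1 + n := hj
        by_cases h : j ≤ m + 1
        · exact ⟨j, h, 0, Nat.zero_le _, Or.inl rfl, by simp [f, h]⟩
        · exact ⟨m + 1, le_rfl, j - (m + 1), by omega, Or.inr rfl, by simp [f, h]⟩
      · rintro ⟨i, hi, j, hj, h | h, rfl⟩
        · subst h
          exact ⟨i, by simp only [mem_Iic]; omega, by simp [f, hi]⟩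
        · subst h
          refine ⟨m + 1 + j, by simp only [mem_Iic]; omega, ?_⟩
          by_cases h0 : j = 0
          · simp [f, h0]
          · have : ¬ (m + 1 + j ≤ m + 1) := by omega
            simp only [f, if_neg this]
            rw [show m + 1 + j - (m + 1) = j by omega]
    rcases n with _ | n
    · convert hchain.hasSymmChains using 1
      rw [hf]
      ext x
      constructor
      · rintro ⟨i, hi, j, hj, h⟩
        exact ⟨i, hi, j, hj, Or.inl (by omega), h⟩
      · rintro ⟨i, hi, j, hj, -, h⟩
        exact ⟨i, hi, j, hj, h⟩
    · have hrest := ih n (s + 1) (fun i j => g i (j + 1)) (by omega)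
        (fun i hi j hj => by rw [hrank i (by omega) (j + 1) (by omega)]; omega)
        (fun i hi j hj => hfst i (by omega) (j + 1) (by omega))
        (fun i hi j hj => hsnd i (by omega) (j + 1) (by omega))
        (fun i hi j hj i' hi' j' hj' h => by
          have := hinj i (by omega) (j + 1) (by omega) i' (by omega) (j' + 1) (by omega) h
          omega)
      convert hchain.hasSymmChains.union hrest ?_ using 1
      · rw [hf]
        ext x
        constructor
        · rintro ⟨i, hi, j, hj, h⟩
          by_cases hc : j = 0 ∨ i = m + 1
          · exact Or.inl ⟨i, hi, j, hj, hc, h⟩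
          · exact Or.inr ⟨i, by omega, j - 1, by omega,
              by simpa [show j - 1 + 1 = j by omega] using h⟩
        · rintro (⟨i, hi, j, hj, -, h⟩ | ⟨i, hi, j, hj, h⟩)
          · exact ⟨i, hi, j, hj, h⟩
          · exact ⟨i, by omega, j + 1, by omega, h⟩
      · rw [hf, Set.disjoint_left]
        rintro x ⟨i, hi, j, hj, hc, rfl⟩ ⟨i', hi', j', hj', h⟩
        have := hinj i' (by omega) (j' + 1) (by omega) i hi j hj h
        omega

/-- Symmetric chain decompositions of `S` and `T` induce one of the image of `S × T` under an
injective map that is strictly increasing in each variable and adds ranks up to a constant. -/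
lemma HasSymmChains.image2 {rX : X → ℕ} {rY : Y → ℕ} {rZ : Z → ℕ} {M N K e : ℕ} {S : Set X}
    {T : Set Y} (F : X → Y → Z) (hS : HasSymmChains rX M S) (hT : HasSymmChains rY N T)
    (hK : M + N + 2 * e = K)
    (hrank : ∀ x ∈ S, ∀ y ∈ T, rZ (F x y) = rX x + rY y + e)
    (hfst : ∀ x ∈ S, ∀ x' ∈ S, x < x' → ∀ y ∈ T, F x y < F x' y)
    (hsnd : ∀ x ∈ S, ∀ y ∈ T, ∀ y' ∈ T, y < y' → F x y < F x y')
    (hinj : ∀ x ∈ S, ∀ y ∈ T, ∀ x' ∈ S, ∀ y' ∈ T, F x y = F x' y' → x = x' ∧ y = y') :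
    HasSymmChains rZ K (Set.image2 F S T) := by
  obtain ⟨C, hC, hCd, rfl⟩ := hS
  obtain ⟨D, hD, hDd, rfl⟩ := hT
  have hun : Set.image2 F (⋃₀ C) (⋃₀ D) = ⋃ q : C × D, Set.image2 F q.1 q.2 := by
    ext z
    simp only [mem_image2, mem_sUnion, mem_iUnion, Prod.exists, Subtype.exists]
    constructor
    · rintro ⟨x, ⟨c, hc, hx⟩, y, ⟨d, hd, hy⟩, h⟩
      exact ⟨c, hc, d, hd, x, hx, y, hy, h⟩
    · rintro ⟨c, hc, d, hd, x, hx, y, hy, h⟩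
      exact ⟨x, ⟨c, hc, hx⟩, y, ⟨d, hd, hy⟩, h⟩
  rw [hun]
  refine HasSymmChains.iUnion ?_ ?_
  · rintro ⟨⟨c, hc⟩, ⟨d, hd⟩⟩
    have hcS : ∀ x ∈ c, x ∈ ⋃₀ C := fun x hx => ⟨c, hc, hx⟩
    have hdT : ∀ x ∈ d, x ∈ ⋃₀ D := fun x hx => ⟨d, hd, hx⟩
    obtain ⟨m, s, f, hm, hfr, hfm, rfl⟩ := hC c hc
    obtain ⟨n, t, g, hn, hgr, hgm, rfl⟩ := hD d hd
    have hf : ∀ i ≤ m, f i ∈ ⋃₀ C := fun i hi => hcS _ ⟨i, hi, rfl⟩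
    have hg : ∀ i ≤ n, g i ∈ ⋃₀ D := fun i hi => hdT _ ⟨i, hi, rfl⟩
    convert hasSymmChains_grid (rank := rZ) (N := K) m n (s + t + e) (fun i j => F (f i) (g j))
      (by omega) ?_ ?_ ?_ ?_ using 1
    · ext z
      simp [mem_image2]
    · intro i hi j hj
      rw [hrank _ (hf i hi) _ (hg j hj), hfr i hi, hgr j hj]; omega
    · intro i hi j hj
      exact hfst _ (hf i hi.le) _ (hf _ hi) (hfm i hi) _ (hg j hj)
    · intro i hi j hj
      exact hsnd _ (hf i hi) _ (hg j hj.le) _ (hg _ hj) (hgm j hj)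
    · intro i hi j hj i' hi' j' hj' h
      obtain ⟨h1, h2⟩ := hinj _ (hf i hi) _ (hg j hj) _ (hf i' hi') _ (hg j' hj') h
      have h1 := congrArg rX h1
      have h2 := congrArg rY h2
      rw [hfr i hi, hfr i' hi'] at h1
      rw [hgr j hj, hgr j' hj'] at h2
      omega
  · rintro ⟨⟨c, hc⟩, ⟨d, hd⟩⟩ ⟨⟨c', hc'⟩, ⟨d', hd'⟩⟩ hne
    rw [Set.disjoint_left]
    rintro _ ⟨x, hx, y, hy, rfl⟩ ⟨x', hx', y', hy', h⟩
    obtain ⟨rfl, rfl⟩ := hinj x' ⟨c', hc', hx'⟩ y' ⟨d', hd', hy'⟩ x ⟨c, hc, hx⟩ y ⟨d, hd, hy⟩ h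
    apply hne
    have h1 : c = c' := by
      by_contra hcc
      exact Set.disjoint_left.1 (hCd hc hc' hcc) hx hx'
    have h2 : d = d' := by
      by_contra hdd
      exact Set.disjoint_left.1 (hDd hd hd' hdd) hy hy'
    subst h1 h2
    rfl

lemma hasSymmChains_singleton {rank : X → ℕ} {N s : ℕ} {x : X} (hx : rank x = s)
    (hN : 2 * s = N) : HasSymmChains rank N {x} :=
  IsSymmChain.hasSymmChains
    ⟨0, s, fun _ => x, by omega, by simp [hx], by simp, by ext; simp⟩

lemma HasSymmChains.image {rX : X → ℕ} {rY : Y → ℕ} {N : ℕ} {S : Set X} (F : X → Y)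
    (hS : HasSymmChains rX N S) (hrank : ∀ x ∈ S, rY (F x) = rX x)
    (hlt : ∀ x ∈ S, ∀ x' ∈ S, x < x' → F x < F x') (hinj : Set.InjOn F S) :
    HasSymmChains rY N (F '' S) := by
  have h := HasSymmChains.image2 (rZ := rY) (e := 0) (fun (x : X) (_ : Unit) => F x) hS
    (hasSymmChains_singleton (rank := fun _ : Unit => 0) (x := ()) rfl rfl) rfl
    (fun x hx y _ => by simpa using hrank x hx) (fun x hx x' hx' h _ _ => hlt x hx x' hx' h)
    (fun x hx y _ y' _ h => (lt_irrefl _ h).elim)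
    (fun x hx y _ x' hx' y' _ h => ⟨hinj hx hx' h, rfl⟩)
  simpa using h

end Chains

/-! ### Noncrossing equivalence relations on a finite linear order -/

section Setoids

variable {α : Type*}

/-- The relation `π` on `U`, with all other elements made singletons. -/
def restrict (U : Finset α) (π : Setoid α) : Setoid α where
  r a b := a = b ∨ (a ∈ U ∧ b ∈ U ∧ π a b)
  iseqv :=
    { refl := fun a => Or.inl rfl
      symm := by
        rintro a b (h | ⟨ha, hb, h⟩)
        · exact Or.inl h.symm
        · exact Or.inr ⟨hb, ha, π.symm h⟩
      trans := by
        rintro a b c (rfl | ⟨ha, hb, h⟩) (rfl | ⟨hb', hc, h'⟩)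
        · exact Or.inl rfl
        · exact Or.inr ⟨hb', hc, h'⟩
        · exact Or.inr ⟨ha, hb, h⟩
        · exact Or.inr ⟨ha, hc, π.trans h h'⟩ }

lemma restrict_rel {U : Finset α} {π : Setoid α} {a b : α} :
    restrict U π a b ↔ a = b ∨ (a ∈ U ∧ b ∈ U ∧ π a b) := Iff.rfl

variable [LinearOrder α]

/-- The elements that are not the least one of their equivalence class. -/
def nonmin (π : Setoid α) : Set α := {a | ∃ b < a, π b a}

/-- The number of elements minus the number of classes, computed by counting the elements that are
not least in their class. Elements in singleton classes do not contribute, so that a partition of a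
subset may be extended by singletons without a change of rank. -/
noncomputable def setoidRank (π : Setoid α) : ℕ := (nonmin π).ncard

lemma nonmin_mono {π σ : Setoid α} (h : π ≤ σ) : nonmin π ⊆ nonmin σ :=
  fun _ ⟨b, hb, hr⟩ => ⟨b, hb, h hr⟩

lemma exists_rel_notMem_nonmin [Finite α] (π : Setoid α) (a : α) : ∃ b, π a b ∧ b ∉ nonmin π := by
  obtain ⟨b, hb, hmin⟩ := (Set.toFinite {b | π a b}).exists_minimal ⟨a, π.refl a⟩
  refine ⟨b, hb, ?_⟩
  rintro ⟨c, hc, hr⟩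
  exact absurd (hmin (π.trans hb (π.symm hr)) hc.le) (not_le.2 hc)

lemma setoidRank_strictMono [Finite α] : StrictMono (setoidRank (α := α)) := by
  intro π σ h
  refine Set.ncard_lt_ncard ((nonmin_mono h.le).ssubset_of_ne ?_) (Set.toFinite _)
  intro heq
  refine h.not_ge ?_
  intro a b hab
  obtain ⟨a', ha, ha'⟩ := exists_rel_notMem_nonmin π a
  obtain ⟨b', hb, hb'⟩ := exists_rel_notMem_nonmin π b
  have hr : σ a' b' := σ.trans (σ.symm (h.le ha)) (σ.trans hab (h.le hb))
  have : a' = b' := by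
    rw [heq] at ha' hb'
    rcases lt_trichotomy a' b' with hlt | heq' | hlt
    · exact absurd ⟨a', hlt, hr⟩ hb'
    · exact heq'
    · exact absurd ⟨b', hlt, σ.symm hr⟩ ha'
  subst this
  exact π.trans ha (π.symm hb)

lemma setoidRank_bot : setoidRank (⊥ : Setoid α) = 0 := by
  have : nonmin (⊥ : Setoid α) = ∅ := by
    ext a
    simp only [nonmin, mem_ofPred_eq, mem_empty_iff_false, iff_false, not_exists, not_and]
    intro b hb h
    exact hb.ne h
  rw [setoidRank, this, Set.ncard_empty]

/-- The equivalence relations on `α` that are trivial outside `V` and noncrossing on `V`. Two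
classes may cross because elements of them alternate, or because an element `b` of one of them lies
between elements `a`, `c` of the other with `T a b c`; the relation `T` stands for collinearity. -/
def NCOn (T : α → α → α → Prop) (V : Finset α) : Set (Setoid α) :=
  {π | (∀ a b, π a b → a = b ∨ (a ∈ V ∧ b ∈ V)) ∧
    (∀ a b c d, a < b → b < c → c < d → π a c → π b d → π a b) ∧
    (∀ a b c, b ∈ V → a < b → b < c → T a b c → π a c → π a b)}

variable {T : α → α → α → Prop} {V W : Finset α}

lemma restrict_mem_NCOn {U : Finset α} {π : Setoid α} (hπ : π ∈ NCOn T V) (hU : U ⊆ V) :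
    restrict U π ∈ NCOn T U := by
  obtain ⟨-, h2, h3⟩ := hπ
  refine ⟨?_, ?_, ?_⟩
  · rintro a b (h | ⟨ha, hb, -⟩)
    · exact Or.inl h
    · exact Or.inr ⟨ha, hb⟩
  · rintro a b c d hab hbc hcd (h | ⟨ha, hc, h⟩) (h' | ⟨hb, hd, h'⟩)
    · exact absurd h (hab.trans hbc).ne
    · exact absurd h (hab.trans hbc).ne
    · exact absurd h' (hbc.trans hcd).ne
    · exact Or.inr ⟨ha, hb, h2 a b c d hab hbc hcd h h'⟩
  · rintro a b c hb hab hbc hT (h | ⟨ha, hc, h⟩)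
    · exact absurd h (hab.trans hbc).ne
    · exact Or.inr ⟨ha, hb, h3 a b c (hU hb) hab hbc hT h⟩

lemma NCOn_empty : NCOn T ∅ = {⊥} := by
  ext π
  constructor
  · rintro ⟨h, -, -⟩
    refine le_bot_iff.1 fun a b hab => ?_
    simpa using h a b hab
  · rintro rfl
    exact ⟨fun a b h => Or.inl h, fun a b c d hab hbc _ h => absurd h (hab.trans hbc).ne,
      fun a b c hb => by simp at hb⟩

lemma NCOn_singleton (x : α) : NCOn T {x} = {⊥} := by
  ext π
  constructor
  · rintro ⟨h, -, -⟩
    refine le_bot_iff.1 fun a b hab => ?_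
    rcases h a b hab with h | ⟨ha, hb⟩
    · exact h
    · rw [Finset.mem_singleton] at ha hb
      rw [ha, hb]
  · rintro rfl
    exact ⟨fun a b h => Or.inl h, fun a b c d hab hbc _ h => absurd h (hab.trans hbc).ne,
      fun a b c _ hab hbc _ h => absurd h (hab.trans hbc).ne⟩

/-- The relation that agrees with `σ` below `k`, with `τ` from `k` on, and in which `x` is moved
into the class of `k`. -/
def graft (x k : α) (σ τ : Setoid α) : Setoid α :=
  Setoid.comap (fun a => if a = x then k else a)
    { r := fun a b => (a < k ∧ b < k ∧ σ a b) ∨ (k ≤ a ∧ k ≤ b ∧ τ a b)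
      iseqv :=
        { refl := fun a => (lt_or_ge a k).imp (fun h => ⟨h, h, σ.refl a⟩) fun h => ⟨h, h, τ.refl a⟩
          symm := by
            rintro a b (⟨ha, hb, h⟩ | ⟨ha, hb, h⟩)
            · exact Or.inl ⟨hb, ha, σ.symm h⟩
            · exact Or.inr ⟨hb, ha, τ.symm h⟩
          trans := by
            rintro a b c (⟨ha, hb, h⟩ | ⟨ha, hb, h⟩) (⟨hb', hc, h'⟩ | ⟨hb', hc, h'⟩)
            · exact Or.inl ⟨ha, hc, σ.trans h h'⟩
            · exact absurd hb (not_lt.2 hb')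
            · exact absurd hb' (not_lt.2 hb)
            · exact Or.inr ⟨ha, hc, τ.trans h h'⟩ } }

lemma graft_rel_of_ne {x k a b : α} {σ τ : Setoid α} (ha : a ≠ x) (hb : b ≠ x) :
    graft x k σ τ a b ↔ (a < k ∧ b < k ∧ σ a b) ∨ (k ≤ a ∧ k ≤ b ∧ τ a b) := by
  rw [graft, Setoid.comap_rel]
  simp only [ha, hb, if_false]

lemma graft_rel_left {x k b : α} {σ τ : Setoid α} (hb : b ≠ x) :
    graft x k σ τ x b ↔ k ≤ b ∧ τ k b := by
  rw [graft, Setoid.comap_rel]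
  simp only [hb, if_false, if_true]
  simp only [lt_irrefl, false_and, le_refl, true_and, false_or]

lemma graft_mono {x k : α} {σ σ' τ τ' : Setoid α} (hσ : σ ≤ σ') (hτ : τ ≤ τ') :
    graft x k σ τ ≤ graft x k σ' τ' := by
  intro a b h
  rcases h with ⟨ha, hb, h⟩ | ⟨ha, hb, h⟩
  · exact Or.inl ⟨ha, hb, hσ h⟩
  · exact Or.inr ⟨ha, hb, hτ h⟩

/-- The part of `V` strictly between `x` and `k`. -/
def between (V : Finset α) (x k : α) : Finset α := {a ∈ V | x < a ∧ a < k}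

/-- The part of `V` from `k` on. -/
def upFrom (V : Finset α) (k : α) : Finset α := {a ∈ V | k ≤ a}

lemma mem_between {x k a : α} : a ∈ between V x k ↔ a ∈ V ∧ x < a ∧ a < k := by simp [between]

lemma mem_upFrom {k a : α} : a ∈ upFrom V k ↔ a ∈ V ∧ k ≤ a := by simp [upFrom]

section Graft

variable {x k : α} {σ τ : Setoid α}

lemma restrict_between_graft (hσ : σ ∈ NCOn T (between V x k)) :
    restrict (between V x k) (graft x k σ τ) = σ := by
  ext a b
  rw [restrict_rel]
  constructor
  · rintro (rfl | ⟨ha, hb, h⟩)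
    · exact σ.refl a
    · rw [mem_between] at ha hb
      rw [graft_rel_of_ne ha.2.1.ne' hb.2.1.ne'] at h
      rcases h with h | h
      · exact h.2.2
      · exact absurd h.1 (not_le.2 ha.2.2)
  · intro h
    rcases hσ.1 a b h with h' | ⟨ha, hb⟩
    · exact Or.inl h'
    · refine Or.inr ⟨ha, hb, ?_⟩
      rw [mem_between] at ha hb
      rw [graft_rel_of_ne ha.2.1.ne' hb.2.1.ne']
      exact Or.inl ⟨ha.2.2, hb.2.2, h⟩

lemma restrict_upFrom_graft (hxk : x < k) (hτ : τ ∈ NCOn T (upFrom V k)) :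
    restrict (upFrom V k) (graft x k σ τ) = τ := by
  ext a b
  rw [restrict_rel]
  constructor
  · rintro (rfl | ⟨ha, hb, h⟩)
    · exact τ.refl a
    · rw [mem_upFrom] at ha hb
      rw [graft_rel_of_ne (hxk.trans_le ha.2).ne' (hxk.trans_le hb.2).ne'] at h
      rcases h with h | h
      · exact absurd ha.2 (not_le.2 h.1)
      · exact h.2.2
  · intro h
    rcases hτ.1 a b h with h' | ⟨ha, hb⟩
    · exact Or.inl h'
    · refine Or.inr ⟨ha, hb, ?_⟩
      rw [mem_upFrom] at ha hb
      rw [graft_rel_of_ne (hxk.trans_le ha.2).ne' (hxk.trans_le hb.2).ne']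
      exact Or.inr ⟨ha.2, hb.2, h⟩

lemma graft_rel_self (hxk : x < k) : graft x k σ τ x k :=
  (graft_rel_left hxk.ne').2 ⟨le_rfl, τ.refl k⟩

lemma graft_not_rel_of_lt {a : α} (hxa : x < a) (hak : a < k) : ¬ graft x k σ τ x a := by
  rw [graft_rel_left hxa.ne']
  exact fun h => absurd h.1 (not_le.2 hak)

lemma graft_mem_NCOn
    (hT : ∀ i i' j k' k, i ≤ i' → i' < j → j < k' → k' ≤ k → T i j k → T i' j k')
    (hx : x ∈ V) (hmin : ∀ a ∈ V, x ≤ a) (hk : k ∈ V) (hxk : x < k)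
    (hflat : ∀ a ∈ V, x < a → a < k → ¬ T x a k)
    (hσ : σ ∈ NCOn T (between V x k)) (hτ : τ ∈ NCOn T (upFrom V k)) :
    graft x k σ τ ∈ NCOn T V := by
  have hsupp : ∀ a b, graft x k σ τ a b → a = b ∨ (a ∈ V ∧ b ∈ V) := by
    have hleft : ∀ b, graft x k σ τ x b → b ∈ V := by
      intro b h
      by_cases hb : b = x
      · rwa [hb]
      · rw [graft_rel_left hb] at h
        rcases hτ.1 k b h.2 with h' | h'
        · rwa [← h']
        · exact (mem_upFrom.1 h'.2).1
    intro a b h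
    by_cases ha : a = x
    · subst ha
      exact Or.inr ⟨hx, hleft b h⟩
    by_cases hb : b = x
    · subst hb
      exact Or.inr ⟨hleft a ((graft b k σ τ).symm h), hx⟩
    rw [graft_rel_of_ne ha hb] at h
    rcases h with ⟨-, -, h⟩ | ⟨-, -, h⟩
    · exact (hσ.1 a b h).imp_right fun h => ⟨(mem_between.1 h.1).1, (mem_between.1 h.2).1⟩
    · exact (hτ.1 a b h).imp_right fun h => ⟨(mem_upFrom.1 h.1).1, (mem_upFrom.1 h.2).1⟩
  refine ⟨hsupp, ?_, ?_⟩
  · intro a b c d hab hbc hcd hac hbd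
    have haV : a ∈ V := ((hsupp a c hac).resolve_left (hab.trans hbc).ne).1
    have hxb : x < b := (hmin a haV).trans_lt hab
    have hxc := hxb.trans hbc
    have hxd := hxc.trans hcd
    rw [graft_rel_of_ne hxb.ne' hxd.ne'] at hbd
    rcases (hmin a haV).eq_or_lt with rfl | hxa
    · rw [graft_rel_left hxc.ne'] at hac
      rw [graft_rel_left hxb.ne']
      rcases hbd with h | ⟨hkb, hkd, hbd⟩
      · exact absurd (hac.1.trans hcd.le) (not_le.2 h.2.1)
      · refine ⟨hkb, ?_⟩
        rcases hkb.eq_or_lt with rfl | hkb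
        · exact τ.refl _
        · exact hτ.2.1 k b c d hkb hbc hcd hac.2 hbd
    · rw [graft_rel_of_ne hxa.ne' hxc.ne'] at hac
      rw [graft_rel_of_ne hxa.ne' hxb.ne']
      rcases hac with ⟨hak, hck, hac⟩ | ⟨hka, hkc, hac⟩
      · rcases hbd with ⟨hbk, hdk, hbd⟩ | ⟨hkb, -, -⟩
        · exact Or.inl ⟨hak, hbk, hσ.2.1 a b c d hab hbc hcd hac hbd⟩
        · exact absurd (hbc.trans hck) (not_lt.2 hkb)
      · rcases hbd with ⟨hbk, -, -⟩ | ⟨hkb, hkd, hbd⟩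
        · exact absurd (hka.trans hab.le) (not_le.2 hbk)
        · exact Or.inr ⟨hka, hkb, hτ.2.1 a b c d hab hbc hcd hac hbd⟩
  · intro a b c hbV hab hbc hTabc hac
    have haV : a ∈ V := ((hsupp a c hac).resolve_left (hab.trans hbc).ne).1
    have hxb : x < b := (hmin a haV).trans_lt hab
    have hxc := hxb.trans hbc
    rcases (hmin a haV).eq_or_lt with rfl | hxa
    · rw [graft_rel_left hxc.ne'] at hac
      rw [graft_rel_left hxb.ne']
      rcases lt_trichotomy b k with hbk | rfl | hkb
      · exact absurd (hT _ _ _ _ _ le_rfl hxb hbk hac.1 hTabc) (hflat b hbV hxb hbk)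
      · exact ⟨le_rfl, τ.refl _⟩
      · exact ⟨hkb.le, hτ.2.2 k b c (mem_upFrom.2 ⟨hbV, hkb.le⟩) hkb hbc
          (hT _ _ _ _ _ hxk.le hkb hbc le_rfl hTabc) hac.2⟩
    · rw [graft_rel_of_ne hxa.ne' hxc.ne'] at hac
      rw [graft_rel_of_ne hxa.ne' hxb.ne']
      rcases hac with ⟨hak, hck, hac⟩ | ⟨hka, hkc, hac⟩
      · have hbk := hbc.trans hck
        exact Or.inl ⟨hak, hbk,
          hσ.2.2 a b c (mem_between.2 ⟨hbV, hxb, hbk⟩) hab hbc hTabc hac⟩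
      · have hkb := hka.trans hab.le
        exact Or.inr ⟨hka, hkb, hτ.2.2 a b c (mem_upFrom.2 ⟨hbV, hkb⟩) hab hbc hTabc hac⟩

/-- A noncrossing relation in which `k` is the successor of the least element `x` in the class of
`x` is determined by its restrictions to the points between `x` and `k` and to those from `k` on:
a class with points in both parts would cross the class of `x`. -/
lemma eq_graft_restrict {π : Setoid α} (hπ : π ∈ NCOn T V) (hmin : ∀ a ∈ V, x ≤ a) (hxk : x < k)
    (hrel : π x k) (hnext : ∀ a, x < a → a < k → ¬ π x a) :
    graft x k (restrict (between V x k) π) (restrict (upFrom V k) π) = π := by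
  have hkV : k ∈ V := ((hπ.1 x k hrel).resolve_left hxk.ne).2
  have hleft : ∀ b, b ≠ x →
      (graft x k (restrict (between V x k) π) (restrict (upFrom V k) π) x b ↔ π x b) := by
    intro b hb
    rw [graft_rel_left hb, restrict_rel, mem_upFrom, mem_upFrom]
    constructor
    · rintro ⟨-, rfl | ⟨-, -, h⟩⟩
      · exact hrel
      · exact π.trans hrel h
    · intro h
      have hbV := ((hπ.1 x b h).resolve_left hb.symm).2
      have hkb : k ≤ b := by
        by_contra hlt
        exact hnext b ((hmin b hbV).lt_of_ne hb.symm) (not_le.1 hlt) h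
      exact ⟨hkb, Or.inr ⟨⟨hkV, le_rfl⟩, ⟨hbV, hkb⟩, π.trans (π.symm hrel) h⟩⟩
  have hsep : ∀ a b, x < a → a < k → k ≤ b → ¬ π a b := by
    intro a b hxa hak hkb h
    rcases hkb.eq_or_lt with rfl | hkb
    · exact hnext a hxa hak (π.trans hrel (π.symm h))
    · exact hnext a hxa hak (hπ.2.1 x a k b hxa hak hkb hrel h)
  ext a b
  by_cases ha : a = x
  · subst ha
    by_cases hb : b = a
    · subst hb
      exact ⟨fun _ => π.refl _, fun _ => Setoid.refl' _ _⟩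
    · exact hleft b hb
  by_cases hb : b = x
  · subst hb
    exact ((Setoid.comm' _).trans (hleft a ha)).trans (Setoid.comm' _)
  rw [graft_rel_of_ne ha hb, restrict_rel, restrict_rel, mem_between, mem_between, mem_upFrom,
    mem_upFrom]
  constructor
  · rintro (⟨-, -, rfl | ⟨-, -, h⟩⟩ | ⟨-, -, rfl | ⟨-, -, h⟩⟩)
    · exact π.refl _
    · exact h
    · exact π.refl _
    · exact h
  · intro h
    rcases hπ.1 a b h with rfl | ⟨haV, hbV⟩
    · rcases lt_or_ge a k with hak | hka
      · exact Or.inl ⟨hak, hak, Or.inl rfl⟩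
      · exact Or.inr ⟨hka, hka, Or.inl rfl⟩
    · have hxa := (hmin a haV).lt_of_ne (Ne.symm ha)
      have hxb := (hmin b hbV).lt_of_ne (Ne.symm hb)
      rcases lt_or_ge a k with hak | hka <;> rcases lt_or_ge b k with hbk | hkb
      · exact Or.inl ⟨hak, hbk, Or.inr ⟨⟨haV, hxa, hak⟩, ⟨hbV, hxb, hbk⟩, h⟩⟩
      · exact absurd h (hsep a b hxa hak hkb)
      · exact absurd (π.symm h) (hsep b a hxb hbk hka)
      · exact Or.inr ⟨hka, hkb, Or.inr ⟨⟨haV, hka⟩, ⟨hbV, hkb⟩, h⟩⟩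

lemma setoidRank_graft [Finite α] (hxk : x < k) (hσ : σ ∈ NCOn T (between V x k))
    (hτ : τ ∈ NCOn T (upFrom V k)) :
    setoidRank (graft x k σ τ) = setoidRank σ + setoidRank τ + 1 := by
  have hσ' : ∀ a ∈ nonmin σ, x < a ∧ a < k := by
    rintro a ⟨b, hb, h⟩
    exact (mem_between.1 ((hσ.1 b a h).resolve_left hb.ne).2).2
  have hτ' : ∀ a ∈ nonmin τ, k < a := by
    rintro a ⟨b, hb, h⟩
    exact (mem_upFrom.1 ((hτ.1 b a h).resolve_left hb.ne).1).2.trans_lt hb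
  have heq : nonmin (graft x k σ τ) = insert k (nonmin σ ∪ nonmin τ) := by
    ext a
    simp only [mem_insert_iff, mem_union]
    constructor
    · rintro ⟨b, hb, h⟩
      by_cases hbx : b = x
      · subst hbx
        rw [graft_rel_left hb.ne'] at h
        rcases h.1.eq_or_lt with rfl | hlt
        · exact Or.inl rfl
        · exact Or.inr (Or.inr ⟨k, hlt, h.2⟩)
      · by_cases hax : a = x
        · subst hax
          rw [Setoid.comm', graft_rel_left hbx] at h
          exact absurd (h.1.trans hb.le) (not_le.2 hxk)
        · rw [graft_rel_of_ne hbx hax] at h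
          rcases h with h | h
          · exact Or.inr (Or.inl ⟨b, hb, h.2.2⟩)
          · exact Or.inr (Or.inr ⟨b, hb, h.2.2⟩)
    · rintro (rfl | ⟨b, hb, h⟩ | ⟨b, hb, h⟩)
      · exact ⟨x, hxk, graft_rel_self hxk⟩
      · obtain ⟨h1, h2⟩ := (hσ.1 b a h).resolve_left hb.ne
        rw [mem_between] at h1 h2
        refine ⟨b, hb, ?_⟩
        rw [graft_rel_of_ne h1.2.1.ne' h2.2.1.ne']
        exact Or.inl ⟨h1.2.2, h2.2.2, h⟩
      · obtain ⟨h1, h2⟩ := (hτ.1 b a h).resolve_left hb.ne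
        rw [mem_upFrom] at h1 h2
        refine ⟨b, hb, ?_⟩
        rw [graft_rel_of_ne (hxk.trans_le h1.2).ne' (hxk.trans_le h2.2).ne']
        exact Or.inr ⟨h1.2, h2.2, h⟩
  rw [setoidRank, heq, Set.ncard_insert_of_notMem _ (Set.toFinite _),
    Set.ncard_union_eq _ (Set.toFinite _) (Set.toFinite _)]
  · rfl
  · rw [Set.disjoint_left]
    exact fun a ha hb => absurd ((hσ' a ha).2.trans (hτ' a hb)) (lt_irrefl _)
  · rintro (h | h)
    · exact lt_irrefl _ (hσ' k h).2
    · exact lt_irrefl _ (hτ' k h)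

end Graft

end Setoids

/-! ### Decomposition by the successor of the least point -/

section Decomposition

variable {α : Type*} [LinearOrder α] {T : α → α → α → Prop} {V : Finset α}

/-- The noncrossing relations in which `k` is the successor of `x` in the class of `x`. -/
def nextSet (T : α → α → α → Prop) (V : Finset α) (x k : α) : Set (Setoid α) :=
  {π | π ∈ NCOn T V ∧ π x k ∧ ∀ a, x < a → a < k → ¬ π x a}

lemma nextSet_eq_image2
    (hT : ∀ i i' j k' k, i ≤ i' → i' < j → j < k' → k' ≤ k → T i j k → T i' j k')
    {x k : α} (hx : x ∈ V) (hmin : ∀ a ∈ V, x ≤ a) (hk : k ∈ V) (hxk : x < k)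
    (hflat : ∀ a ∈ V, x < a → a < k → ¬ T x a k) :
    nextSet T V x k = Set.image2 (graft x k) (NCOn T (between V x k)) (NCOn T (upFrom V k)) := by
  ext π
  constructor
  · rintro ⟨hπ, hrel, hnext⟩
    exact ⟨_, restrict_mem_NCOn hπ (Finset.filter_subset _ _), _,
      restrict_mem_NCOn hπ (Finset.filter_subset _ _), eq_graft_restrict hπ hmin hxk hrel hnext⟩
  · rintro ⟨σ, hσ, τ, hτ, rfl⟩
    exact ⟨graft_mem_NCOn hT hx hmin hk hxk hflat hσ hτ, graft_rel_self hxk,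
      fun a hxa hak => graft_not_rel_of_lt hxa hak⟩

/-- For `k` beyond the second point, the relations in which `k` follows the least point `x` form a
product of two smaller posets of noncrossing relations, or the empty set if a point between `x` and
`k` is collinear with them. Both factors live on nonempty sets, so that the top ranks
`card - 1` are not truncated and add up, with the shift by one, to a centered family. -/
lemma hasSymmChains_nextSet [Finite α]
    (hT : ∀ i i' j k' k, i ≤ i' → i' < j → j < k' → k' ≤ k → T i j k → T i' j k')
    {x k : α} (hx : x ∈ V) (hmin : ∀ a ∈ V, x ≤ a) (hk : k ∈ V) (hxk : x < k)
    (hne : (between V x k).Nonempty)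
    (ih : ∀ W : Finset α, W.card < V.card → W.Nonempty →
      HasSymmChains setoidRank (W.card - 1) (NCOn T W)) :
    HasSymmChains setoidRank (V.card - 1) (nextSet T V x k) := by
  by_cases hflat : ∀ a ∈ V, x < a → a < k → ¬ T x a k
  · have hcard : V.card = (between V x k).card + (upFrom V k).card + 1 := by
      have h1 : V = insert x (between V x k ∪ upFrom V k) := by
        ext a
        rw [Finset.mem_insert, Finset.mem_union, mem_between, mem_upFrom]
        constructor
        · intro ha
          rcases (hmin a ha).eq_or_lt with h | h
          · exact Or.inl h.symm
          · exact Or.inr ((lt_or_ge a k).imp (fun h' => ⟨ha, h, h'⟩) fun h' => ⟨ha, h'⟩)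
        · rintro (rfl | h | h)
          · exact hx
          · exact h.1
          · exact h.1
      conv_lhs => rw [h1]
      rw [Finset.card_insert_of_notMem, Finset.card_union_of_disjoint]
      · rw [Finset.disjoint_left]
        intro a ha hb
        exact absurd (mem_upFrom.1 hb).2 (not_le.2 (mem_between.1 ha).2.2)
      · rw [Finset.mem_union, mem_between, mem_upFrom]
        rintro (h | h)
        · exact lt_irrefl _ h.2.1
        · exact absurd h.2 (not_le.2 hxk)
    have hne' : (upFrom V k).Nonempty := ⟨k, mem_upFrom.2 ⟨hk, le_rfl⟩⟩
    have hp := hne.card_pos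
    have hp' := hne'.card_pos
    have hinj : ∀ σ ∈ NCOn T (between V x k), ∀ τ ∈ NCOn T (upFrom V k),
        ∀ σ' ∈ NCOn T (between V x k), ∀ τ' ∈ NCOn T (upFrom V k),
        graft x k σ τ = graft x k σ' τ' → σ = σ' ∧ τ = τ' := by
      intro σ hσ τ hτ σ' hσ' τ' hτ' h
      constructor
      · rw [← restrict_between_graft (τ := τ) hσ, h, restrict_between_graft hσ']
      · rw [← restrict_upFrom_graft (σ := σ) hxk hτ, h, restrict_upFrom_graft hxk hτ']
    rw [nextSet_eq_image2 hT hx hmin hk hxk hflat]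
    refine HasSymmChains.image2 (e := 1) (graft x k) (ih _ (by omega) hne) (ih _ (by omega) hne')
      (by omega) (fun σ hσ τ hτ => setoidRank_graft hxk hσ hτ) ?_ ?_ hinj
    · intro σ hσ σ' hσ' h τ hτ
      exact lt_of_le_of_ne (graft_mono h.le le_rfl)
        fun heq => h.ne (hinj σ hσ τ hτ σ' hσ' τ hτ heq).1
    · intro σ hσ τ hτ τ' hτ' h
      exact lt_of_le_of_ne (graft_mono le_rfl h.le)
        fun heq => h.ne (hinj σ hσ τ hτ σ hσ τ' hτ' heq).2
  · push Not at hflat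
    obtain ⟨a, ha, hxa, hak, hTa⟩ := hflat
    convert HasSymmChains.empty setoidRank (V.card - 1)
    rw [Set.eq_empty_iff_forall_notMem]
    rintro π ⟨hπ, hrel, hnext⟩
    exact hnext a hxa hak (hπ.2.2 x a k ha hxa hak hTa hrel)

/-- If `y` is the point of `V` after the least point `x`, then the relations in which `x` is
isolated and those in which `y` follows `x` form two copies of the poset for `V \ {x}`, and hence
the product of this poset with a chain of length one. -/
lemma hasSymmChains_isolated_or_second [Finite α]
    (hT : ∀ i i' j k' k, i ≤ i' → i' < j → j < k' → k' ≤ k → T i j k → T i' j k')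
    {x y : α} (hx : x ∈ V) (hmin : ∀ a ∈ V, x ≤ a) (hy : y ∈ V) (hxy : x < y)
    (hbetween : between V x y = ∅)
    (ih : HasSymmChains setoidRank ((upFrom V y).card - 1) (NCOn T (upFrom V y))) :
    HasSymmChains setoidRank (upFrom V y).card (NCOn T (upFrom V y) ∪ nextSet T V x y) := by
  have hflat : ∀ a ∈ V, x < a → a < y → ¬ T x a y := fun a ha hxa hay =>
    absurd (mem_between.2 ⟨ha, hxa, hay⟩) (by simp [hbetween])
  have hbot : (⊥ : Setoid α) ∈ NCOn T (between V x y) := by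
    rw [hbetween, NCOn_empty]; rfl
  have hpos : 0 < (upFrom V y).card := Finset.card_pos.2 ⟨y, mem_upFrom.2 ⟨hy, le_rfl⟩⟩
  let F : Setoid α → Bool → Setoid α := fun π b => cond b (graft x y ⊥ π) π
  have himage : NCOn T (upFrom V y) ∪ nextSet T V x y =
      Set.image2 F (NCOn T (upFrom V y)) univ := by
    rw [nextSet_eq_image2 hT hx hmin hy hxy hflat, hbetween, NCOn_empty, image2_singleton_left]
    ext π
    simp [F]
  have htwo : HasSymmChains Bool.toNat 1 (univ : Set Bool) := by
    refine IsSymmChain.hasSymmChains ⟨1, 0, fun j => decide (j ≠ 0), rfl, ?_, ?_, ?_⟩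
    · intro j hj
      interval_cases j <;> rfl
    · intro j hj
      interval_cases j
      decide
    · ext b
      cases b
      · simp
      · simpa using ⟨1, by simp⟩
  have hxiso : ∀ π ∈ NCOn T (upFrom V y), ¬ π x y := by
    intro π hπ h
    have := ((hπ.1 x y h).resolve_left hxy.ne).1
    exact absurd (mem_upFrom.1 this).2 (not_le.2 hxy)
  have hrestrict : ∀ π ∈ NCOn T (upFrom V y), ∀ b, restrict (upFrom V y) (F π b) = π := by
    rintro π hπ (_ | _)
    · ext a b
      exact ⟨fun h => h.elim (fun h => h ▸ π.refl a) fun h => h.2.2,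
        fun h => (hπ.1 a b h).imp_right fun h' => ⟨h'.1, h'.2, h⟩⟩
    · exact restrict_upFrom_graft hxy hπ
  have hrelxy : ∀ π ∈ NCOn T (upFrom V y), ∀ b, F π b x y ↔ b = true := by
    rintro π hπ (_ | _)
    · simpa [F] using hxiso π hπ
    · simpa [F] using graft_rel_self hxy
  have hinj : ∀ π ∈ NCOn T (upFrom V y), ∀ b ∈ univ, ∀ π' ∈ NCOn T (upFrom V y), ∀ b' ∈ univ,
      F π b = F π' b' → π = π' ∧ b = b' := by
    intro π hπ b _ π' hπ' b' _ h
    constructor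
    · rw [← hrestrict π hπ b, h, hrestrict π' hπ' b']
    · rw [Bool.eq_iff_iff, ← hrelxy π hπ b, h, hrelxy π' hπ' b']
  rw [himage]
  refine HasSymmChains.image2 (e := 0) F ih htwo (by omega) ?_ ?_ ?_ hinj
  · rintro π hπ (_ | _) -
    · simp [F]
    · simp [F, setoidRank_graft hxy hbot hπ, setoidRank_bot]
  · rintro π hπ π' hπ' h b -
    refine lt_of_le_of_ne ?_ fun heq => h.ne (hinj π hπ b trivial π' hπ' b trivial heq).1
    cases b
    · exact h.le
    · exact graft_mono le_rfl h.le
  · rintro π hπ b - b' - h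
    refine lt_of_le_of_ne ?_ fun heq => h.ne (hinj π hπ b trivial π hπ b' trivial heq).2
    obtain ⟨rfl, rfl⟩ : b = false ∧ b' = true := by
      revert h; cases b <;> cases b' <;> decide
    intro a c hac
    rcases hπ.1 a c hac with rfl | ⟨ha, hc⟩
    · exact Setoid.refl' _ _
    · rw [mem_upFrom] at ha hc
      exact (graft_rel_of_ne (hxy.trans_le ha.2).ne' (hxy.trans_le hc.2).ne').2
        (Or.inr ⟨ha.2, hc.2, hac⟩)

/-- The noncrossing relations on a nonempty finite set have a symmetric chain decomposition,
provided that collinearity passes to subintervals. -/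
theorem hasSymmChains_NCOn [Finite α]
    (hT : ∀ i i' j k' k, i ≤ i' → i' < j → j < k' → k' ≤ k → T i j k → T i' j k')
    (V : Finset α) (hV : V.Nonempty) : HasSymmChains setoidRank (V.card - 1) (NCOn T V) := by
  induction hn : V.card using Nat.strong_induction_on generalizing V with
  | _ n ih =>
    subst hn
    have ih' : ∀ W : Finset α, W.card < V.card → W.Nonempty →
        HasSymmChains setoidRank (W.card - 1) (NCOn T W) := fun W hW hne => ih _ hW W hne rfl
    set x := V.min' hV with hxdef
    have hx : x ∈ V := V.min'_mem hV
    have hmin : ∀ a ∈ V, x ≤ a := fun a ha => V.min'_le a ha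
    by_cases hW : (V.erase x).Nonempty
    · set y := (V.erase x).min' hW with hydef
      have hyW : y ∈ V.erase x := (V.erase x).min'_mem hW
      have hy : y ∈ V := Finset.mem_of_mem_erase hyW
      have hxy : x < y := (hmin y hy).lt_of_ne (Finset.ne_of_mem_erase hyW).symm
      have hysnd : ∀ a ∈ V, x < a → y ≤ a := fun a ha hxa =>
        (V.erase x).min'_le a (Finset.mem_erase.2 ⟨hxa.ne', ha⟩)
      have hfrom : upFrom V y = V.erase x := by
        ext a
        rw [mem_upFrom, Finset.mem_erase]
        exact ⟨fun h => ⟨(hxy.trans_le h.2).ne', h.1⟩,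
          fun h => ⟨h.2, hysnd a h.2 ((hmin a h.2).lt_of_ne h.1.symm)⟩⟩
      have hcard : (upFrom V y).card = V.card - 1 := by rw [hfrom, Finset.card_erase_of_mem hx]
      have hVpos := hV.card_pos
      have hbetween : between V x y = ∅ := by
        rw [Finset.eq_empty_iff_forall_notMem]
        intro a ha
        rw [mem_between] at ha
        exact absurd (hysnd a ha.1 ha.2.1) (not_le.2 ha.2.2)
      have h1 := hasSymmChains_isolated_or_second hT hx hmin hy hxy hbetween
        (ih' _ (by omega) (hfrom ▸ hW))
      rw [hcard] at h1
      have h2 : HasSymmChains setoidRank (V.card - 1)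
          (⋃ k : {k // k ∈ V ∧ y < k}, nextSet T V x k) := by
        refine HasSymmChains.iUnion ?_ ?_
        · rintro ⟨k, hk, hyk⟩
          exact hasSymmChains_nextSet hT hx hmin hk (hxy.trans hyk)
            ⟨y, mem_between.2 ⟨hy, hxy, hyk⟩⟩ ih'
        · rintro ⟨k, hk, hyk⟩ ⟨l, hl, hyl⟩ hne
          rw [Set.disjoint_left]
          rintro π ⟨-, hr, hn⟩ ⟨-, hr', hn'⟩
          rcases lt_trichotomy k l with h | h | h
          · exact hn' k (hxy.trans hyk) h hr
          · exact hne (Subtype.ext h)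
          · exact hn l (hxy.trans hyl) h hr'
      convert h1.union h2 ?_ using 1
      · ext π
        simp only [mem_union, mem_iUnion, Subtype.exists]
        constructor
        · intro hπ
          by_cases hiso : ∃ a, x < a ∧ π x a
          · obtain ⟨k, ⟨hxk, hk⟩, hkmin⟩ :=
              (Set.toFinite {a | x < a ∧ π x a}).exists_minimal hiso
            have hkV : k ∈ V := ((hπ.1 x k hk).resolve_left hxk.ne).2
            have hmem : π ∈ nextSet T V x k :=
              ⟨hπ, hk, fun a hxa hak h => absurd (hkmin ⟨hxa, h⟩ hak.le) (not_le.2 hak)⟩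
            rcases (hysnd k hkV hxk).eq_or_lt with h | h
            · exact Or.inl (Or.inr (h ▸ hmem))
            · exact Or.inr ⟨k, ⟨hkV, h⟩, hmem⟩
          · left; left
            have hsub : upFrom V y ⊆ V := Finset.filter_subset _ _
            have hres := restrict_mem_NCOn hπ hsub
            convert hres using 1
            ext a b
            rw [restrict_rel]
            refine ⟨fun h => ?_, fun h => h.elim (fun h => h ▸ π.refl a) fun h => h.2.2⟩
            by_cases hab : a = b
            · exact Or.inl hab
            obtain ⟨ha, hb⟩ := (hπ.1 a b h).resolve_left hab
            refine Or.inr ⟨?_, ?_, h⟩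
            · refine mem_upFrom.2 ⟨ha, hysnd a ha ((hmin a ha).lt_of_ne ?_)⟩
              rintro hxa
              exact hiso ⟨b, (hmin b hb).lt_of_ne (hxa ▸ hab), hxa ▸ h⟩
            · refine mem_upFrom.2 ⟨hb, hysnd b hb ((hmin b hb).lt_of_ne ?_)⟩
              rintro hxb
              exact hiso ⟨a, (hmin a ha).lt_of_ne (hxb ▸ Ne.symm hab), hxb ▸ π.symm h⟩
        · rintro ((hπ | hπ) | ⟨k, -, hπ⟩)
          · refine ⟨fun a b h => (hπ.1 a b h).imp_right fun h' =>
              ⟨(mem_upFrom.1 h'.1).1, (mem_upFrom.1 h'.2).1⟩, hπ.2.1, ?_⟩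
            intro a b c hb hab hbc hTabc hac
            have ha := (mem_upFrom.1 ((hπ.1 a c hac).resolve_left (hab.trans hbc).ne).1).2
            exact hπ.2.2 a b c (mem_upFrom.2 ⟨hb, ha.trans hab.le⟩) hab hbc hTabc hac
          · exact hπ.1
          · exact hπ.1
      · rw [Set.disjoint_left]
        rintro π hπ hπ'
        obtain ⟨⟨k, hk, hyk⟩, -, hr, hn⟩ := mem_iUnion.1 hπ'
        have hxk := hxy.trans hyk
        rcases hπ with hπ | hπ
        · exact absurd (mem_upFrom.1 ((hπ.1 x k hr).resolve_left hxk.ne).1).2 (not_le.2 hxy)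
        · exact hn y hxy hyk hπ.2.1
    · have hVx : V = {x} := by
        rw [Finset.not_nonempty_iff_eq_empty, Finset.erase_eq_empty_iff] at hW
        exact hW.resolve_left hV.ne_empty
      have h1 : NCOn T V = {⊥} := by
        rw [hVx]
        exact NCOn_singleton x
      have h2 : V.card = 1 := by
        rw [hVx]
        exact Finset.card_singleton x
      rw [h1, h2]
      exact hasSymmChains_singleton setoidRank_bot rfl

end Decomposition

/-! ### Convex hulls of points in weakly convex position -/

/-- Twice the signed area of the triangle `a b c`. -/
def cross (a b c : ℂ) : ℝ := (b.re - a.re) * (c.im - a.im) - (b.im - a.im) * (c.re - a.re)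

lemma cross_rotate (a b c : ℂ) : cross a b c = cross b c a := by
  unfold cross; ring

lemma cross_swap (a b c : ℂ) : cross a b c = -cross a c b := by
  unfold cross; ring

lemma mem_openSegment_param {a b z : ℂ} (h : z ∈ openSegment ℝ a b) :
    ∃ t : ℝ, 0 < t ∧ t < 1 ∧ z = a + t * (b - a) := by
  obtain ⟨u, t, hu, ht, hut, rfl⟩ := h
  refine ⟨t, ht, by linarith, ?_⟩
  rw [Complex.real_smul, Complex.real_smul, show u = 1 - t by linarith]
  push_cast; ring

lemma cross_line_right (a b c : ℂ) (t : ℝ) :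
    cross a (b + t * (c - b)) c = (1 - t) * cross a b c := by
  simp only [cross, Complex.add_re, Complex.add_im, Complex.mul_re, Complex.mul_im,
    Complex.ofReal_re, Complex.ofReal_im, Complex.sub_re, Complex.sub_im]
  ring

lemma cross_line_left (a b c : ℂ) (t : ℝ) : cross a (a + t * (c - a)) b = t * cross a c b := by
  simp only [cross, Complex.add_re, Complex.add_im, Complex.mul_re, Complex.mul_im,
    Complex.ofReal_re, Complex.ofReal_im, Complex.sub_re, Complex.sub_im]
  ring

lemma cross_eq_zero_of_mem_openSegment {a b z : ℂ} (h : z ∈ openSegment ℝ a b) :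
    cross a z b = 0 := by
  obtain ⟨t, -, -, rfl⟩ := mem_openSegment_param h
  rw [cross_line_left]
  unfold cross
  ring

lemma exists_param_of_cross_eq_zero {a b z : ℂ} (hab : a ≠ b) (h : cross a z b = 0) :
    ∃ t : ℝ, z = a + t * (b - a) := by
  have hd : 0 < (b.re - a.re) ^ 2 + (b.im - a.im) ^ 2 := by
    by_contra hd
    have h1 : (b.re - a.re) ^ 2 = 0 := by
      nlinarith [sq_nonneg (b.re - a.re), sq_nonneg (b.im - a.im)]
    have h2 : (b.im - a.im) ^ 2 = 0 := by
      nlinarith [sq_nonneg (b.re - a.re), sq_nonneg (b.im - a.im)]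
    refine hab (Complex.ext ?_ ?_)
    · linarith [pow_eq_zero_iff (two_ne_zero) |>.1 h1]
    · linarith [pow_eq_zero_iff (two_ne_zero) |>.1 h2]
  refine ⟨((z.re - a.re) * (b.re - a.re) + (z.im - a.im) * (b.im - a.im)) /
    ((b.re - a.re) ^ 2 + (b.im - a.im) ^ 2), ?_⟩
  unfold cross at h
  apply Complex.ext
  · simp only [Complex.add_re, Complex.mul_re, Complex.ofReal_re, Complex.ofReal_im,
      Complex.sub_re, Complex.sub_im]
    field_simp
    linear_combination (b.im - a.im) * h
  · simp only [Complex.add_im, Complex.mul_im, Complex.ofReal_re, Complex.ofReal_im,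
      Complex.sub_re, Complex.sub_im]
    field_simp
    linear_combination -(b.re - a.re) * h

section Convex

variable {α : Type*} [LinearOrder α]

/-- The points `p i` are in weakly convex position, in counterclockwise order: each triple is
positively oriented or collinear with its middle point inside the segment of the other two. This
condition passes to all subfamilies. -/
def WeaklyConvex (p : α → ℂ) : Prop :=
  ∀ i j k, i < j → j < k → 0 < cross (p i) (p j) (p k) ∨ p j ∈ openSegment ℝ (p i) (p k)

variable {p : α → ℂ}

lemma WeaklyConvex.cross_nonneg (hp : WeaklyConvex p) {i j k : α} (hij : i ≤ j) (hjk : j ≤ k) :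
    0 ≤ cross (p i) (p j) (p k) := by
  rcases hij.eq_or_lt with rfl | hij
  · simp [cross]
  rcases hjk.eq_or_lt with rfl | hjk
  · unfold cross; nlinarith
  rcases hp i j k hij hjk with h | h
  · exact h.le
  · exact (cross_eq_zero_of_mem_openSegment h).ge

lemma WeaklyConvex.mem_openSegment (hp : WeaklyConvex p) {i j k : α} (hij : i < j) (hjk : j < k)
    (h : cross (p i) (p j) (p k) = 0) : p j ∈ openSegment ℝ (p i) (p k) :=
  (hp i j k hij hjk).resolve_left h.not_gt

/-- If one point between `i` and `k` is collinear with them, then all points from `i` to `k` lie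
on a line. -/
lemma WeaklyConvex.cross_eq_zero (hp : WeaklyConvex p) (hinj : Function.Injective p)
    {i i' j k' k : α} (hi : i ≤ i') (hij : i' < j) (hjk : j < k') (hk : k' ≤ k)
    (h : cross (p i) (p j) (p k) = 0) : cross (p i') (p j) (p k') = 0 := by
  have hij' := hi.trans_lt hij
  have hjk' := hjk.trans_le hk
  obtain ⟨t, ht0, ht1, hjt⟩ := mem_openSegment_param (hp.mem_openSegment hij' hjk' h)
  -- A point `m` off the line would make the triple of `m`, `j` and one of `i`, `k` negative.
  have hflat : ∀ m, i ≤ m → m ≤ k → cross (p i) (p m) (p k) = 0 := by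
    intro m him hmk
    refine le_antisymm ?_ (hp.cross_nonneg him hmk)
    rcases le_total m j with hmj | hjm
    · have h1 := hp.cross_nonneg hmj hjk'.le
      have h2 : cross (p m) (p j) (p k) = -(1 - t) * cross (p i) (p m) (p k) := by
        rw [hjt, cross_line_right]
        unfold cross; ring
      rw [h2] at h1
      nlinarith
    · have h1 := hp.cross_nonneg hij'.le hjm
      rw [hjt, cross_line_left, cross_swap] at h1
      nlinarith
  have hne : p i ≠ p k := fun h => (hij'.trans hjk').ne (hinj h)
  have hk'i : i ≤ k' := (hij'.trans hjk).le
  have hi'k : i' ≤ k := (hij.trans hjk').le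
  obtain ⟨u, hu⟩ := exists_param_of_cross_eq_zero hne (hflat i' hi hi'k)
  obtain ⟨v, hv⟩ := exists_param_of_cross_eq_zero hne (hflat k' hk'i hk)
  rw [hu, hv, hjt]
  simp only [cross, Complex.add_re, Complex.add_im, Complex.mul_re, Complex.mul_im,
    Complex.ofReal_re, Complex.ofReal_im, Complex.sub_re, Complex.sub_im]
  ring

/-- The diagonals of a weakly convex quadrilateral meet. -/
lemma WeaklyConvex.segment_inter (hp : WeaklyConvex p) {a b c d : α} (hab : a < b) (hbc : b < c)
    (hcd : c < d) : ∃ z, z ∈ segment ℝ (p a) (p c) ∧ z ∈ segment ℝ (p b) (p d) := by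
  rcases hp a b c hab hbc with h1 | h1
  · have h2 := hp.cross_nonneg (hab.trans hbc).le hcd.le
    have h3 := hp.cross_nonneg hbc.le hcd.le
    have h4 := hp.cross_nonneg hab.le (hbc.trans hcd).le
    have hsum : cross (p a) (p b) (p c) + cross (p a) (p c) (p d) =
        cross (p b) (p c) (p d) + cross (p a) (p b) (p d) := by
      unfold cross; ring
    have hpos : 0 < cross (p a) (p b) (p c) + cross (p a) (p c) (p d) := by linarith
    have hpos' : 0 < cross (p b) (p c) (p d) + cross (p a) (p b) (p d) := hsum ▸ hpos
    -- The intersection point divides each diagonal in the ratio of the areas cut off by the other.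
    refine ⟨(cross (p b) (p c) (p d) / (cross (p b) (p c) (p d) + cross (p a) (p b) (p d))) • p a +
      (cross (p a) (p b) (p d) / (cross (p b) (p c) (p d) + cross (p a) (p b) (p d))) • p c,
      ⟨_, _, by positivity, by positivity, by field_simp, rfl⟩,
      cross (p a) (p c) (p d) / (cross (p a) (p b) (p c) + cross (p a) (p c) (p d)),
      cross (p a) (p b) (p c) / (cross (p a) (p b) (p c) + cross (p a) (p c) (p d)),
      by positivity, by positivity, by field_simp; ring, ?_⟩
    rw [hsum]
    apply Complex.ext
    · simp only [Complex.add_re, Complex.smul_re, smul_eq_mul]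
      field_simp
      unfold cross; ring
    · simp only [Complex.add_im, Complex.smul_im, smul_eq_mul]
      field_simp
      unfold cross; ring
  · exact ⟨p b, openSegment_subset_segment ℝ _ _ h1, left_mem_segment ℝ _ _⟩

/-- The signed position of `z` along the line from `a` to `b`. -/
def along (a b z : ℂ) : ℝ := (b.re - a.re) * (z.re - a.re) + (b.im - a.im) * (z.im - a.im)

lemma cross_combo (a b z w : ℂ) {s t : ℝ} (h : s + t = 1) :
    cross a (s • z + t • w) b = s * cross a z b + t * cross a w b := by
  obtain rfl : s = 1 - t := by linarith
  simp only [cross, Complex.add_re, Complex.add_im, Complex.smul_re, Complex.smul_im, smul_eq_mul]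
  ring

lemma along_combo (a b z w : ℂ) {s t : ℝ} (h : s + t = 1) :
    along a b (s • z + t • w) = s * along a b z + t * along a b w := by
  obtain rfl : s = 1 - t := by linarith
  simp only [along, Complex.add_re, Complex.add_im, Complex.smul_re, Complex.smul_im, smul_eq_mul]
  ring

/-- The open half-plane to the left of the line from `a` to `b`, together with the closed half-line
on this line that starts in `a` and points away from `b`. The complement is convex as well. -/
def lexHalfPlane (a b : ℂ) : Set ℂ := {z | cross a z b < 0 ∨ (cross a z b = 0 ∧ along a b z ≤ 0)}

lemma convex_lexHalfPlane (a b : ℂ) : Convex ℝ (lexHalfPlane a b) := by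
  rw [convex_iff_forall_pos]
  rintro z hz w hw s t hs ht hst
  simp only [lexHalfPlane, mem_ofPred_eq, cross_combo a b z w hst, along_combo a b z w hst] at *
  rcases hz with hz | ⟨hz, hz'⟩ <;> rcases hw with hw | ⟨hw, hw'⟩
  · left; nlinarith
  · left; rw [hw]; nlinarith
  · left; rw [hz]; nlinarith
  · right; rw [hz, hw]; exact ⟨by ring, by nlinarith⟩

lemma convex_compl_lexHalfPlane (a b : ℂ) : Convex ℝ (lexHalfPlane a b)ᶜ := by
  rw [convex_iff_forall_pos]
  rintro z hz w hw s t hs ht hst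
  simp only [lexHalfPlane, mem_compl_iff, mem_ofPred_eq, not_or, not_and, not_lt, not_le,
    cross_combo a b z w hst, along_combo a b z w hst] at *
  obtain ⟨hz, hz'⟩ := hz
  obtain ⟨hw, hw'⟩ := hw
  refine ⟨by positivity, fun h => ?_⟩
  have h1 : cross a z b = 0 := by nlinarith [mul_nonneg hs.le hz, mul_nonneg ht.le hw]
  have h2 : cross a w b = 0 := by nlinarith [mul_nonneg hs.le hz, mul_nonneg ht.le hw]
  have := hz' h1
  have := hw' h2
  positivity

lemma disjoint_convexHull_of_convex {A B H : Set ℂ} (hH : Convex ℝ H) (hH' : Convex ℝ Hᶜ)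
    (hA : A ⊆ H) (hB : B ⊆ Hᶜ) : Disjoint (convexHull ℝ A) (convexHull ℝ B) :=
  disjoint_compl_right.mono (convexHull_min hA hH) (convexHull_min hB hH')

lemma convex_cross_nonpos (a b : ℂ) : Convex ℝ {z | cross a z b ≤ 0} := by
  rw [convex_iff_forall_pos]
  rintro z hz w hw s t hs ht hst
  simp only [mem_ofPred_eq, cross_combo a b z w hst] at *
  nlinarith

lemma convex_compl_cross_nonpos (a b : ℂ) : Convex ℝ {z | cross a z b ≤ 0}ᶜ := by
  rw [convex_iff_forall_pos]
  rintro z hz w hw s t hs ht hst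
  simp only [mem_compl_iff, mem_ofPred_eq, cross_combo a b z w hst, not_le] at *
  positivity

lemma along_pos_of_mem_openSegment {a b z : ℂ} (hab : a ≠ b) (h : z ∈ openSegment ℝ a b) :
    0 < along a b z := by
  obtain ⟨t, ht0, -, rfl⟩ := mem_openSegment_param h
  have hd : 0 < along a b b := by
    by_contra hd
    unfold along at hd
    refine hab (Complex.ext ?_ ?_) <;> nlinarith [sq_nonneg (b.re - a.re), sq_nonneg (b.im - a.im)]
  have : along a b (a + t * (b - a)) = t * along a b b := by
    simp only [along, Complex.add_re, Complex.add_im, Complex.mul_re, Complex.mul_im,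
      Complex.ofReal_re, Complex.ofReal_im, Complex.sub_re, Complex.sub_im]
    ring
  rw [this]
  positivity

/-- If all elements of `A` precede all elements of `B`, then the line from the last point of `A` to
the last point of `B` separates the hulls, where points on this line are separated by their
position on it. -/
lemma WeaklyConvex.disjoint_of_lt (hp : WeaklyConvex p) (hinj : Function.Injective p)
    {A B : Set α} (hA : A.Finite) (hB : B.Finite) (hA0 : A.Nonempty) (hB0 : B.Nonempty)
    (h : ∀ a ∈ A, ∀ b ∈ B, a < b) :
    Disjoint (convexHull ℝ (p '' A)) (convexHull ℝ (p '' B)) := by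
  obtain ⟨m, hm, hmax⟩ := Set.exists_max_image A id hA hA0
  obtain ⟨l, hl, hlmax⟩ := Set.exists_max_image B id hB hB0
  have hml := h m hm l hl
  have hne : p m ≠ p l := fun h => hml.ne (hinj h)
  refine disjoint_convexHull_of_convex (convex_lexHalfPlane (p m) (p l))
    (convex_compl_lexHalfPlane (p m) (p l)) ?_ ?_
  · rintro _ ⟨a, ha, rfl⟩
    rcases (hmax a ha).eq_or_lt with (heq : a = m) | (hlt : a < m)
    · subst heq
      right
      simp [cross, along]
    · rcases hp a m l hlt hml with h1 | h1
      · left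
        unfold cross at *
        linarith
      · right
        have h2 := cross_eq_zero_of_mem_openSegment h1
        obtain ⟨t, ht0, ht1, hmt⟩ := mem_openSegment_param h1
        refine ⟨?_, ?_⟩
        · unfold cross at *; linarith
        · rw [hmt]
          simp only [along, Complex.add_re, Complex.add_im, Complex.mul_re, Complex.mul_im,
            Complex.ofReal_re, Complex.ofReal_im, Complex.sub_re, Complex.sub_im]
          have : 0 ≤ t * (1 - t) * (((p l).re - (p a).re) ^ 2 + ((p l).im - (p a).im) ^ 2) := by
            have : 0 ≤ 1 - t := by linarith
            positivity
          linarith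
  · rintro _ ⟨b, hb, rfl⟩
    simp only [lexHalfPlane, mem_compl_iff, mem_ofPred_eq, not_or, not_and, not_lt, not_le]
    have hmb := h m hm b hb
    refine ⟨hp.cross_nonneg hmb.le (hlmax b hb), fun hc => ?_⟩
    rcases (hlmax b hb).eq_or_lt with (heq : b = l) | (hlt : b < l)
    · subst heq
      by_contra hd
      unfold along at hd
      refine hne (Complex.ext ?_ ?_) <;>
        nlinarith [sq_nonneg ((p b).re - (p m).re), sq_nonneg ((p b).im - (p m).im)]
    · exact along_pos_of_mem_openSegment hne (hp.mem_openSegment hmb hlt hc)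

/-- Two disjoint index sets have disjoint hulls as soon as their elements do not alternate and no
element of one lies between two elements of the other with which it is collinear: one of them
precedes the other, or lies in a gap `(a, c)` of the other, and then the line through the points
`a` and `c` separates. -/
lemma WeaklyConvex.disjoint_convexHull (hp : WeaklyConvex p) (hinj : Function.Injective p)
    {A B : Set α} (hA : A.Finite) (hB : B.Finite) (hA0 : A.Nonempty) (hB0 : B.Nonempty)
    (hAB : Disjoint A B)
    (h1 : ∀ a ∈ A, ∀ b ∈ B, ∀ c ∈ A, ∀ d ∈ B, a < b → b < c → ¬ c < d)
    (h2 : ∀ b ∈ B, ∀ a ∈ A, ∀ d ∈ B, ∀ c ∈ A, b < a → a < d → ¬ d < c)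
    (h3 : ∀ a ∈ A, ∀ b ∈ B, ∀ c ∈ A, a < b → b < c → cross (p a) (p b) (p c) ≠ 0)
    (h4 : ∀ b ∈ B, ∀ a ∈ A, ∀ d ∈ B, b < a → a < d → cross (p b) (p a) (p d) ≠ 0) :
    Disjoint (convexHull ℝ (p '' A)) (convexHull ℝ (p '' B)) := by
  obtain ⟨a₀, ha₀, hamin⟩ := Set.exists_min_image A id hA hA0
  obtain ⟨b₀, hb₀, hbmin⟩ := Set.exists_min_image B id hB hB0
  wlog hlt : a₀ < b₀ generalizing A B a₀ b₀
  · refine (this hB hA hB0 hA0 hAB.symm h2 h1 h4 h3 b₀ hb₀ hbmin a₀ ha₀ hamin ?_).symm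
    refine (not_lt.1 hlt).lt_of_ne ?_
    rintro rfl
    exact Set.disjoint_left.1 hAB ha₀ hb₀
  by_cases hall : ∀ a ∈ A, a < b₀
  · exact hp.disjoint_of_lt hinj hA hB hA0 hB0 fun a ha b hb => (hall a ha).trans_le (hbmin b hb)
  · push Not at hall
    obtain ⟨a', ha', hba'⟩ := hall
    obtain ⟨a, ⟨haA, hab⟩, hamax⟩ := Set.exists_max_image {a ∈ A | a < b₀} id
      (hA.subset (sep_subset _ _)) ⟨a₀, ha₀, hlt⟩
    obtain ⟨c, ⟨hcA, hbc⟩, hcmin⟩ := Set.exists_min_image {a ∈ A | b₀ ≤ a} id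
      (hA.subset (sep_subset _ _)) ⟨a', ha', hba'⟩
    have hbc : b₀ < c := hbc.lt_of_ne fun h => Set.disjoint_left.1 hAB hcA (h ▸ hb₀)
    refine disjoint_convexHull_of_convex (convex_cross_nonpos (p a) (p c))
      (convex_compl_cross_nonpos (p a) (p c)) ?_ ?_
    · rintro _ ⟨x, hx, rfl⟩
      change cross (p a) (p x) (p c) ≤ 0
      rcases lt_or_ge x b₀ with hxb | hbx
      · have := hp.cross_nonneg (hamax x ⟨hx, hxb⟩) (hab.trans hbc).le
        simp only [id] at this
        unfold cross at *; linarith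
      · have := hp.cross_nonneg (hab.trans hbc).le (hcmin x ⟨hx, hbx⟩)
        simp only [id] at this
        unfold cross at *; linarith
    · rintro _ ⟨b, hb, rfl⟩
      change ¬ cross (p a) (p b) (p c) ≤ 0
      have hab' : a < b := hab.trans_le (hbmin b hb)
      have hbc' : b < c := by
        refine (not_lt.1 (h1 a haA b₀ hb₀ c hcA b hb hab hbc)).lt_of_ne ?_
        rintro rfl
        exact Set.disjoint_left.1 hAB hcA hb
      rw [not_le]
      exact (hp.cross_nonneg hab'.le hbc'.le).lt_of_ne (h3 a haA b hb c hcA hab' hbc').symm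

end Convex

/-! ### Ordering a hull configuration -/

lemma add_smul_mem_openSegment {a b : ℂ} {t : ℝ} (h0 : 0 < t) (h1 : t < 1) :
    a + t * (b - a) ∈ openSegment ℝ a b := by
  refine ⟨1 - t, t, by linarith, h0, by ring, ?_⟩
  rw [Complex.real_smul, Complex.real_smul]
  push_cast; ring

/-- Cramer's rule. -/
lemma eq_add_of_cross_ne_zero {x a b : ℂ} (h : cross x a b ≠ 0) (z : ℂ) :
    z = x + (cross x z b / cross x a b : ℝ) * (a - x) +
      (cross x a z / cross x a b : ℝ) * (b - x) := by
  apply Complex.ext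
  · simp only [Complex.add_re, Complex.mul_re, Complex.ofReal_re, Complex.ofReal_im,
      Complex.sub_re, Complex.sub_im]
    field_simp
    unfold cross; ring
  · simp only [Complex.add_im, Complex.mul_im, Complex.ofReal_re, Complex.ofReal_im,
      Complex.sub_re, Complex.sub_im]
    field_simp
    unfold cross; ring

/-- A convex combination of four points of a convex set is an interior point if three of the four
points form a proper triangle and occur with positive weights. -/
lemma mem_interior_of_combination {S : Set ℂ} (hS : Convex ℝ S) {x a b c : ℂ} (hx : x ∈ S)
    (ha : a ∈ S) (hb : b ∈ S) (hc : c ∈ S) (hab : cross x a b ≠ 0) {r s t : ℝ} (hr : 0 < r)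
    (hs : 0 < s) (ht : 0 ≤ t) (hrst : r + s + t < 1) :
    x + r * (a - x) + s * (b - x) + t * (c - x) ∈ interior S := by
  let u : ℂ → ℝ := fun z => cross x (z - t * (c - x)) b / cross x a b
  let v : ℂ → ℝ := fun z => cross x a (z - t * (c - x)) / cross x a b
  have hu : Continuous u := by unfold u cross; fun_prop
  have hv : Continuous v := by unfold v cross; fun_prop
  rw [mem_interior]
  refine ⟨{z | 0 < u z ∧ 0 < v z ∧ u z + v z + t < 1}, ?_, ?_, ?_⟩
  · rintro z ⟨h1, h2, h3⟩
    have hz := eq_add_of_cross_ne_zero hab (z - t * (c - x))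
    have hz' : z = x + (u z : ℂ) * (a - x) + (v z : ℂ) * (b - x) + t * (c - x) := by
      linear_combination hz
    have hmem := hS.sum_mem (t := Finset.univ) (w := ![1 - u z - v z - t, u z, v z, t])
      (z := ![x, a, b, c]) ?_ ?_ ?_
    · rw [hz']
      convert hmem using 1
      simp only [Fin.sum_univ_four, Complex.real_smul, Matrix.cons_val]
      push_cast; ring
    · intro i _
      fin_cases i
      · simpa using by linarith
      · simpa using h1.le
      · simpa using h2.le
      · simpa using ht
    · simp only [Fin.sum_univ_four, Matrix.cons_val]; ring
    · intro i _
      fin_cases i <;> simpa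
  · exact (isOpen_lt continuous_const hu).inter ((isOpen_lt continuous_const hv).inter
      (isOpen_lt ((hu.add hv).add continuous_const) continuous_const))
  · have h1 : u (x + r * (a - x) + s * (b - x) + t * (c - x)) = r := by
      rw [div_eq_iff hab]
      simp only [cross, Complex.add_re, Complex.add_im, Complex.mul_re, Complex.mul_im,
        Complex.ofReal_re, Complex.ofReal_im, Complex.sub_re, Complex.sub_im]
      ring
    have h2 : v (x + r * (a - x) + s * (b - x) + t * (c - x)) = s := by
      rw [div_eq_iff hab]
      simp only [cross, Complex.add_re, Complex.add_im, Complex.mul_re, Complex.mul_im,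
        Complex.ofReal_re, Complex.ofReal_im, Complex.sub_re, Complex.sub_im]
      ring
    exact ⟨h1.symm ▸ hr, h2.symm ▸ hs, by rw [h1, h2]; exact hrst⟩

lemma cross_eq_arg {x d : ℂ} (hd : d ≠ 0) (p q : ℂ) :
    cross x p q = Complex.normSq d * (‖(p - x) / d‖ * ‖(q - x) / d‖ *
      Real.sin (((q - x) / d).arg - ((p - x) / d).arg)) := by
  have hp : p = x + d * ((p - x) / d) := by field_simp; ring
  have hq : q = x + d * ((q - x) / d) := by field_simp; ring
  generalize (p - x) / d = u at *
  generalize (q - x) / d = v at *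
  subst hp hq
  have h1 := Complex.norm_mul_cos_arg u
  have h2 := Complex.norm_mul_sin_arg u
  have h3 := Complex.norm_mul_cos_arg v
  have h4 := Complex.norm_mul_sin_arg v
  have : ‖u‖ * ‖v‖ * Real.sin (v.arg - u.arg) = u.re * v.im - u.im * v.re := by
    rw [Real.sin_sub, ← h1, ← h2, ← h3, ← h4]; ring
  rw [this]
  simp only [cross, Complex.add_re, Complex.add_im, Complex.mul_re, Complex.mul_im,
    Complex.normSq_apply]
  ring

lemma eq_add_of_arg_eq {x d p q : ℂ} (hd : d ≠ 0) (hq : q ≠ x)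
    (harg : ((p - x) / d).arg = ((q - x) / d).arg) (hlt : ‖(q - x) / d‖ < ‖(p - x) / d‖) :
    ∃ t : ℝ, 0 < t ∧ t < 1 ∧ q = x + t * (p - x) := by
  have hq' : (q - x) / d ≠ 0 := div_ne_zero (sub_ne_zero.2 hq) hd
  have hqn : 0 < ‖(q - x) / d‖ := norm_pos_iff.2 hq'
  have hpn := hqn.trans hlt
  refine ⟨‖(q - x) / d‖ / ‖(p - x) / d‖, by positivity, (div_lt_one hpn).2 hlt, ?_⟩
  have h := (Complex.arg_eq_arg_iff (norm_pos_iff.1 hpn) hq').1 harg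
  push_cast
  field_simp at h ⊢
  linear_combination -h

/-- Points in the plane whose hull has the blank side `[x, y]` and none of which is interior to the
hull are in weakly convex position when they are ordered counterclockwise from `y` to `x`: by the
angle at `x`, and by decreasing distance from `x` on the side that ends in `x`. -/
lemma exists_order_of_blank_side {P : Finset ℂ} {x y : ℂ} (hx : x ∈ P) (hy : y ∈ P) (hxy : x ≠ y)
    (hside : ∀ p ∈ P, p ≠ x → p ≠ y → 0 < cross x y p)
    (hint : ∀ z ∈ P, z ∉ interior (Conv P)) :
    ∃ _ : LinearOrder P, WeaklyConvex (fun i : P => (i : ℂ)) := by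
  have hd : y - x ≠ 0 := sub_ne_zero.2 hxy.symm
  set w : ℂ → ℂ := fun p => (p - x) / (y - x) with hw
  have hK : 0 < Complex.normSq (y - x) := Complex.normSq_pos.2 hd
  have hwy : w y = 1 := div_self hd
  have hcross : ∀ p, cross x y p = Complex.normSq (y - x) * (w p).im := by
    intro p
    have hp : p = x + (y - x) * w p := by simp only [hw]; field_simp; ring
    conv_lhs => rw [hp]
    simp only [cross, Complex.add_re, Complex.add_im, Complex.mul_re, Complex.mul_im,
      Complex.normSq_apply, Complex.sub_re, Complex.sub_im]
    ring
  have him : ∀ p ∈ P, p ≠ x → p ≠ y → 0 < (w p).im := by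
    intro p hp hpx hpy
    have := hside p hp hpx hpy
    rw [hcross] at this
    exact (mul_pos_iff_of_pos_left hK).1 this
  have hnn : ∀ p ∈ P, p ≠ x → 0 ≤ (w p).arg := by
    intro p hp hpx
    by_cases hpy : p = y
    · rw [hpy, hwy, Complex.arg_one]
    · exact Complex.arg_nonneg_iff.2 (him p hp hpx hpy).le
  have hpi : ∀ p ∈ P, p ≠ x → (w p).arg < Real.pi := by
    intro p hp hpx
    by_cases hpy : p = y
    · rw [hpy, hwy, Complex.arg_one]
      exact Real.pi_pos
    · exact Complex.arg_lt_pi_iff.2 (Or.inr (him p hp hpx hpy).ne')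
  have hpos : ∀ p ∈ P, p ≠ x → p ≠ y → 0 < (w p).arg := by
    intro p hp hpx hpy
    refine (hnn p hp hpx).lt_of_ne fun h => ?_
    exact (him p hp hpx hpy).ne' (Complex.arg_eq_zero_iff.1 h.symm).2
  have hwne : ∀ p, p ≠ x → w p ≠ 0 := fun p hp => div_ne_zero (sub_ne_zero.2 hp) hd
  have hlt : ∀ p ∈ P, p ≠ x → ∀ q ∈ P, q ≠ x → (w p).arg < (w q).arg → 0 < cross x p q := by
    intro p hp hpx q hq hqx h
    rw [cross_eq_arg hd p q]
    have h1 : 0 < ‖w p‖ := norm_pos_iff.2 (hwne p hpx)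
    have h2 : 0 < ‖w q‖ := norm_pos_iff.2 (hwne q hqx)
    have h3 : 0 < Real.sin ((w q).arg - (w p).arg) :=
      Real.sin_pos_of_pos_of_lt_pi (by linarith) (by linarith [hnn p hp hpx, hpi q hq hqx])
    positivity
  let θ : ℂ → ℝ := fun p => if p = x then Real.pi else (w p).arg
  have hθx : θ x = Real.pi := if_pos rfl
  have hθ : ∀ p, p ≠ x → θ p = (w p).arg := fun p hp => if_neg hp
  let key : P → ℝ ×ₗ ℝ := fun p => toLex (θ p, -‖w p‖)
  have hkey : Function.Injective key := by
    rintro ⟨p, hp⟩ ⟨q, hq⟩ h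
    have h' : (θ p, -‖w p‖) = (θ q, -‖w q‖) := toLex.injective h
    obtain ⟨h1, h2⟩ := Prod.mk.inj h'
    refine Subtype.ext ?_
    by_cases hpx : p = x <;> by_cases hqx : q = x
    · exact hpx.trans hqx.symm
    · subst hpx
      rw [hθx, hθ q hqx] at h1
      exact absurd h1.symm (hpi q hq hqx).ne
    · subst hqx
      rw [hθx, hθ p hpx] at h1
      exact absurd h1 (hpi p hp hpx).ne
    · rw [hθ p hpx, hθ q hqx] at h1
      have hweq : w p = w q := Complex.ext_norm_arg (neg_injective h2) h1
      simp only [hw] at hweq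
      rw [div_left_inj' hd] at hweq
      exact sub_left_injective hweq
  refine ⟨LinearOrder.lift' key hkey, ?_⟩
  have hltkey : ∀ i j : P, key i < key j →
      (i : ℂ) ≠ x ∧ ((j : ℂ) ≠ x → (w i).arg < (w j).arg ∨
        (w i).arg = (w j).arg ∧ ‖w j‖ < ‖w i‖) := by
    rintro ⟨p, hp⟩ ⟨q, hq⟩ h
    have h' := (Prod.Lex.toLex_lt_toLex).1 h
    simp only at h' ⊢
    have hpx : p ≠ x := by
      rintro rfl
      by_cases hqx : q = p
      · subst hqx
        exact lt_irrefl _ h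
      · rw [hθx, hθ q hqx] at h'
        have := hpi q hq hqx
        rcases h' with h' | ⟨h', -⟩ <;> linarith
    refine ⟨hpx, fun hqx => ?_⟩
    rw [hθ p hpx, hθ q hqx] at h'
    exact h'.imp_right fun h => ⟨h.1, neg_lt_neg_iff.1 h.2⟩
  intro i j k hij hjk
  obtain ⟨hpx, hpq⟩ := hltkey i j hij
  obtain ⟨hqx, hqr⟩ := hltkey j k hjk
  have hmemConv : ∀ p ∈ P, p ∈ Conv P := fun p hp => subset_convexHull ℝ _ hp
  have hconv : Convex ℝ (Conv P) := convex_convexHull ℝ _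
  obtain ⟨p, hp⟩ := i
  obtain ⟨q, hq⟩ := j
  obtain ⟨r, hr⟩ := k
  simp only at hpx hpq hqx hqr ⊢
  have hpq := hpq hqx
  by_cases hrx : r = x
  · subst hrx
    rcases hpq with h | ⟨h, hn⟩
    · left
      rw [← cross_rotate]
      exact hlt p hp hpx q hq hqx h
    · right
      obtain ⟨t, ht0, ht1, ht⟩ := eq_add_of_arg_eq hd hqx h hn
      rw [openSegment_symm, ht]
      exact add_smul_mem_openSegment ht0 ht1
  have hqr := hqr hrx
  have harea : cross p q r = cross x p q + cross x q r - cross x p r := by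
    unfold cross; ring
  rcases hpq with hpq | ⟨hpq, hpqn⟩ <;> rcases hqr with hqr | ⟨hqr, hqrn⟩
  · -- `q` lies in the open cone at `x` over the segment `[p, r]`, and not inside the triangle.
    have h1 := hlt p hp hpx q hq hqx hpq
    have h2 := hlt q hq hqx r hr hrx hqr
    have h3 := hlt p hp hpx r hr hrx (hpq.trans hqr)
    have hc := eq_add_of_cross_ne_zero h3.ne' q
    rw [harea]
    rcases lt_trichotomy (cross x p q + cross x q r) (cross x p r) with h | h | h
    · refine absurd ?_ (hint q hq)
      have := mem_interior_of_combination (r := cross x q r / cross x p r)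
        (s := cross x p q / cross x p r) (t := 0) hconv (hmemConv x hx) (hmemConv p hp)
        (hmemConv r hr) (hmemConv x hx) h3.ne' (by positivity) (by positivity) le_rfl
        (by rw [add_zero, ← add_div, div_lt_one h3]; linarith)
      rw [sub_self, mul_zero, add_zero, ← hc] at this
      exact this
    · right
      have hlt1 : cross x p q / cross x p r < 1 := (div_lt_one h3).2 (by linarith)
      have hsum : cross x q r / cross x p r = 1 - cross x p q / cross x p r := by
        rw [eq_sub_iff_add_eq, ← add_div, add_comm, h, div_self h3.ne']
      rw [hsum] at hc
      have : q = p + (cross x p q / cross x p r : ℝ) * (r - p) := by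
        push_cast at hc ⊢
        linear_combination hc
      rw [this]
      exact add_smul_mem_openSegment (by positivity) hlt1
    · left; linarith
  · left
    obtain ⟨t, ht0, ht1, ht⟩ := eq_add_of_arg_eq hd hrx hqr hqrn
    have h1 := hlt p hp hpx q hq hqx hpq
    have h2 : cross p q r = (1 - t) * cross x p q := by
      rw [ht]
      simp only [cross, Complex.add_re, Complex.add_im, Complex.mul_re, Complex.mul_im,
        Complex.ofReal_re, Complex.ofReal_im, Complex.sub_re, Complex.sub_im]
      ring
    rw [h2]
    have : 0 < 1 - t := by linarith
    positivity
  · -- `q` would lie between `x` and `p`, inside the hull of `x`, `y`, `p`, `r`.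
    exfalso
    obtain ⟨t, ht0, ht1, ht⟩ := eq_add_of_arg_eq hd hqx hpq hpqn
    have hpy : p ≠ y := by
      rintro rfl
      have hqy : q ≠ p := by
        rintro rfl
        exact lt_irrefl _ hpqn
      have := hpos q hq hqx hqy
      rw [← hpq, hwy, Complex.arg_one] at this
      exact lt_irrefl _ this
    have hyp : (w y).arg < (w p).arg := by
      rw [hwy, Complex.arg_one]
      exact hpos p hp hpx hpy
    have h1 := hlt y hy hxy.symm p hp hpx hyp
    have h2 := hlt p hp hpx r hr hrx (hpq.trans_lt hqr)
    have h3 := hlt y hy hxy.symm r hr hrx (hyp.trans (hpq.trans_lt hqr))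
    have hc := eq_add_of_cross_ne_zero h3.ne' p
    have hA : 0 < cross x p r / cross x y r := by positivity
    have hB : 0 < cross x y p / cross x y r := by positivity
    generalize cross x p r / cross x y r = A at hc hA
    generalize cross x y p / cross x y r = B at hc hB
    -- A small part of the weight `t` of `p` is moved to `y` and `r`.
    obtain ⟨e, he0, het, he1⟩ : ∃ e : ℝ, 0 < e ∧ e ≤ t ∧ e * (A + B) < 1 - t := by
      have ht1' : 0 < 1 - t := by linarith
      refine ⟨t * (1 - t) / (1 + A + B), by positivity, ?_, ?_⟩
      · rw [div_le_iff₀ (by positivity)]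
        nlinarith [mul_pos ht0 hA, mul_pos ht0 hB, mul_pos ht0 ht0]
      · rw [div_mul_eq_mul_div, div_lt_iff₀ (by positivity)]
        nlinarith [mul_pos ht1' hA, mul_pos ht1' hB, mul_pos (mul_pos ht1' ht1') hA,
          mul_pos (mul_pos ht1' ht1') hB]
    refine hint q hq ?_
    have := mem_interior_of_combination (r := e * A) (s := e * B) (t := t - e) hconv
      (hmemConv x hx) (hmemConv y hy) (hmemConv r hr) (hmemConv p hp) h3.ne' (by positivity)
      (by positivity) (by linarith) (by nlinarith)
    convert this using 1
    rw [ht]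
    push_cast
    linear_combination (e : ℂ) * hc
  · right
    obtain ⟨t, ht0, ht1, ht⟩ := eq_add_of_arg_eq hd hqx hpq hpqn
    obtain ⟨s, hs0, hs1, hs⟩ := eq_add_of_arg_eq hd hrx hqr hqrn
    have hst : s * t < t := by nlinarith
    have hden : 0 < 1 - s * t := by linarith
    have hq' : q = p + ((1 - t) / (1 - s * t) : ℝ) * (r - p) := by
      have hden' : (1 - s * t : ℂ) ≠ 0 := by exact_mod_cast hden.ne'
      have hrp : r - p = -(1 - s * t : ℂ) * (p - x) := by rw [hs, ht]; ring
      rw [hrp, ht]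
      push_cast
      rw [div_mul_eq_mul_div, eq_comm, ← eq_sub_iff_add_eq', div_eq_iff hden']
      ring
    rw [hq']
    refine add_smul_mem_openSegment (div_pos (by linarith) hden) ?_
    rw [div_lt_one hden]
    linarith

/-- Since a side is an exposed face, all points outside a blank side lie strictly on one side of
it. -/
lemma exists_oriented_side {P : Finset ℂ} (h : HasBlankSide P) :
    ∃ x ∈ P, ∃ y ∈ P, x ≠ y ∧ ∀ p ∈ P, p ≠ x → p ≠ y → 0 < cross x y p := by
  obtain ⟨x, hx, y, hy, hxy, hexp, hblank⟩ := h
  obtain ⟨l, hl⟩ := hexp ⟨x, left_mem_segment ℝ x y⟩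
  have hxl : ∀ z ∈ Conv P, l z ≤ l x := by
    have := left_mem_segment ℝ x y
    rw [hl] at this
    exact this.2
  have hyl : ∀ z ∈ Conv P, l z ≤ l y := by
    have := right_mem_segment ℝ x y
    rw [hl] at this
    exact this.2
  have hmem : ∀ p ∈ P, p ∈ Conv P := fun p hp => subset_convexHull ℝ _ hp
  have hlxy : l x = l y := le_antisymm (hyl x (hmem x hx)) (hxl y (hmem y hy))
  have hlt : ∀ p ∈ P, p ≠ x → p ≠ y → l p < l x := by
    intro p hp hpx hpy
    refine (hxl p (hmem p hp)).lt_of_ne fun heq => ?_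
    have : p ∈ segment ℝ x y := by
      rw [hl]
      exact ⟨hmem p hp, fun z hz => heq ▸ hxl z hz⟩
    exact (hblank p hp this).elim hpx hpy
  have hform : ∀ z : ℂ, l z = z.re * l 1 + z.im * l Complex.I := by
    intro z
    have : z = z.re • (1 : ℂ) + z.im • Complex.I := by
      simp [Complex.re_add_im]
    conv_lhs => rw [this]
    rw [map_add, map_smul, map_smul, smul_eq_mul, smul_eq_mul]
  generalize l 1 = A at hform
  generalize l Complex.I = B at hform
  have hAB : (y.re - x.re) * A + (y.im - x.im) * B = 0 := by
    rw [hform, hform] at hlxy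
    linarith
  -- By `hAB`, the gradient `(A, B)` of `l` is the direction of the side turned by a right angle,
  -- up to a factor.
  have hkey : ∀ p ∈ P, p ≠ x → p ≠ y →
      cross x y p * ((y.re - x.re) * B - (y.im - x.im) * A) < 0 := by
    intro p hp hpx hpy
    have h1 := hlt p hp hpx hpy
    rw [hform, hform] at h1
    have hd : 0 < (y.re - x.re) ^ 2 + (y.im - x.im) ^ 2 := by
      by_contra hd
      refine hxy (Complex.ext ?_ ?_) <;>
        nlinarith [sq_nonneg (y.re - x.re), sq_nonneg (y.im - x.im)]
    have h2 : cross x y p * ((y.re - x.re) * B - (y.im - x.im) * A) =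
        ((y.re - x.re) ^ 2 + (y.im - x.im) ^ 2) *
          ((p.re * A + p.im * B) - (x.re * A + x.im * B)) := by
      unfold cross
      linear_combination
        (-(p.re - x.re) * (y.re - x.re) - (p.im - x.im) * (y.im - x.im)) * hAB
    rw [h2]
    exact mul_neg_of_pos_of_neg hd (by linarith)
  rcases lt_or_ge ((y.re - x.re) * B - (y.im - x.im) * A) 0 with hneg | hnn
  · refine ⟨x, hx, y, hy, hxy, fun p hp hpx hpy => ?_⟩
    have := hkey p hp hpx hpy
    by_contra hc
    nlinarith
  · refine ⟨y, hy, x, hx, hxy.symm, fun p hp hpy hpx => ?_⟩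
    have := hkey p hp hpx hpy
    have hrev : cross y x p = - cross x y p := by unfold cross; ring
    rw [hrev]
    by_contra hc
    nlinarith

lemma IsOneDimensional.nonempty {P : Finset ℂ} (h : IsOneDimensional P) : P.Nonempty := by
  rw [Finset.nonempty_iff_ne_empty]
  rintro rfl
  rw [IsOneDimensional, Conv, Finset.coe_empty, convexHull_empty, vectorSpan_empty,
    finrank_bot] at h
  exact zero_ne_one h

lemma exists_order_of_isOneDimensional {P : Finset ℂ} (h : IsOneDimensional P) :
    ∃ _ : LinearOrder P, WeaklyConvex (fun i : P => (i : ℂ)) := by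
  obtain ⟨⟨v, hvs⟩, hv0, hv⟩ := finrank_eq_one_iff'.1 h
  obtain ⟨x, hx⟩ := h.nonempty
  have hparam : ∀ p : P, ∃ t : ℝ, (p : ℂ) = x + t * v := by
    intro p
    have hmem : (p : ℂ) -ᵥ x ∈ vectorSpan ℝ (Conv P) :=
      vsub_mem_vectorSpan ℝ (subset_convexHull ℝ _ p.2) (subset_convexHull ℝ _ hx)
    obtain ⟨t, ht⟩ := hv ⟨_, hmem⟩
    refine ⟨t, ?_⟩
    have := congrArg Subtype.val ht
    simp only [SetLike.mk_smul_mk, Complex.real_smul, vsub_eq_sub] at this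
    rw [this]; ring
  choose t ht using hparam
  have hinj : Function.Injective t := fun p q hpq => Subtype.ext (by rw [ht p, ht q, hpq])
  refine ⟨LinearOrder.lift' t hinj, fun i j k hij hjk => Or.inr ?_⟩
  have h1 : t i < t j := hij
  have h2 : t j < t k := hjk
  have hd : 0 < t k - t i := by linarith
  have hj : (j : ℂ) = i + ((t j - t i) / (t k - t i) : ℝ) * ((k : ℂ) - i) := by
    have hd' : (t k - t i : ℂ) ≠ 0 := by exact_mod_cast hd.ne'
    rw [ht i, ht j, ht k]
    push_cast
    field_simp
    ring
  simp only
  rw [hj]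
  refine add_smul_mem_openSegment (div_pos (by linarith) hd) ?_
  rw [div_lt_one hd]
  linarith

/-! ### Noncrossing partitions as equivalence relations -/

section Partitions

variable {P : Finset ℂ}

/-- The equivalence relation on the points of `P` whose classes are the blocks of `π`. -/
noncomputable def blockRel (π : Finpartition P) : Setoid P := Setoid.ker fun i : P => π.part i

lemma blockRel_iff {π : Finpartition P} {i j : P} : blockRel π i j ↔ π.part i = π.part j := Iff.rfl

lemma blockRel_iff_mem {π : Finpartition P} {i j : P} : blockRel π i j ↔ (j : ℂ) ∈ π.part i := by
  rw [blockRel_iff, eq_comm, π.part_eq_iff_mem (π.part_mem.2 i.2)]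

lemma blockRel_le_iff {π σ : Finpartition P} : blockRel π ≤ blockRel σ ↔ π ≤ σ := by
  constructor
  · intro h B hB
    obtain ⟨z, hz⟩ := π.nonempty_of_mem_parts hB
    have hzP : z ∈ P := π.subset hB hz
    refine ⟨σ.part z, σ.part_mem.2 hzP, fun z' hz' => ?_⟩
    have hr : blockRel π ⟨z, hzP⟩ ⟨z', π.subset hB hz'⟩ := by
      rw [blockRel_iff, π.part_eq_of_mem hB hz, π.part_eq_of_mem hB hz']
    exact blockRel_iff_mem.1 (h hr)
  · intro h i j hij
    obtain ⟨C, hC, hle⟩ := h (π.part_mem.2 i.2)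
    rw [blockRel_iff, σ.part_eq_of_mem hC (hle (π.mem_part_self.2 i.2)),
      σ.part_eq_of_mem hC (hle (blockRel_iff_mem.1 hij))]

lemma exists_blockRel_eq (s : Setoid P) : ∃ π : Finpartition P, blockRel π = s := by
  classical
  let f : ℂ → Option (Quotient s) := fun z => if h : z ∈ P then some ⟦⟨z, h⟩⟧ else none
  refine ⟨Finpartition.ofSetSetoid (Setoid.ker f) P, ?_⟩
  ext i j
  rw [blockRel_iff_mem, Finpartition.mem_part_ofSetSetoid_iff_rel]
  simp only [Setoid.ker_def, f, i.2, j.2, dif_pos, Option.some.injEq, true_and]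
  exact Quotient.eq

lemma IsSymmChain.isSaturatedChain {X : Type*} [PartialOrder X] {rank : X → ℕ} {N : ℕ}
    {c : Set X} (hr : StrictMono rank) (hc : IsSymmChain rank N c) : IsSaturatedChain c := by
  obtain ⟨m, s, f, -, hrank, hlt, rfl⟩ := hc
  refine ⟨(List.range (m + 1)).map f, ?_, ?_⟩
  · rw [List.isChain_map, List.isChain_range]
    intro j hj
    have hj : j < m := by omega
    refine ⟨hlt j hj, fun x h1 h2 => ?_⟩
    have h1 := hr h1
    have h2 := hr h2
    rw [hrank j hj.le] at h1
    rw [hrank (j + 1) hj] at h2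
    omega
  · ext x
    simp

lemma IsSymmChain.isCentered {c : Set (NC P)} (hc : IsSymmChain rk (P.card - 1) c) :
    IsCentered c := by
  obtain ⟨m, s, f, hN, hrank, -, rfl⟩ := hc
  have hcount : ∀ k, {π ∈ f '' Iic m | rk π = k}.ncard = if s ≤ k ∧ k ≤ s + m then 1 else 0 := by
    intro k
    split_ifs with h
    · rw [ncard_eq_one]
      refine ⟨f (k - s), ?_⟩
      ext π
      constructor
      · rintro ⟨⟨j, hj, rfl⟩, hk⟩
        rw [hrank j hj] at hk
        rw [mem_singleton_iff, show k - s = j by omega]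
      · rintro rfl
        have hk : k - s ≤ m := by omega
        exact ⟨⟨k - s, hk, rfl⟩, by rw [hrank _ hk]; omega⟩
    · rw [ncard_eq_zero ((toFinite _).subset (sep_subset _ _)), Set.eq_empty_iff_forall_notMem]
      rintro _ ⟨⟨j, hj, rfl⟩, hk⟩
      have hj' : j ≤ m := hj
      rw [hrank j hj] at hk
      omega
  intro k l hkl
  rw [hcount, hcount]
  congr 1
  rw [eq_iff_iff]
  omega

variable [LinearOrder P]

lemma card_parts_add_setoidRank (π : Finpartition P) :
    π.parts.card + setoidRank (blockRel π) = P.card := by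
  have himage : (fun i : P => π.part i) '' (nonmin (blockRel π))ᶜ = (π.parts : Set (Finset ℂ)) := by
    ext B
    constructor
    · rintro ⟨i, -, rfl⟩
      exact π.part_mem.2 i.2
    · intro hB
      obtain ⟨z, hz⟩ := π.nonempty_of_mem_parts hB
      obtain ⟨i, hi, hi'⟩ := exists_rel_notMem_nonmin (blockRel π) ⟨z, π.subset hB hz⟩
      exact ⟨i, hi', (blockRel_iff.1 hi).symm.trans (π.part_eq_of_mem hB hz)⟩
  have hinj : InjOn (fun i : P => π.part i) (nonmin (blockRel π))ᶜ := by
    intro i hi j hj hij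
    rcases lt_trichotomy i j with h | h | h
    · exact absurd ⟨i, h, hij⟩ hj
    · exact h
    · exact absurd ⟨j, h, hij.symm⟩ hi
  have hcard := hinj.ncard_image
  rw [himage, ncard_coe_finset] at hcard
  rw [hcard, setoidRank, add_comm, Set.ncard_add_ncard_compl]
  simp

lemma rk_eq_setoidRank (π : NC P) : rk π = setoidRank (blockRel π.1) := by
  have := card_parts_add_setoidRank π.1
  unfold rk
  omega

/-- For points in weakly convex position, a partition is noncrossing if and only if its relation is
noncrossing in the combinatorial sense. -/
lemma blockRel_mem_NCOn_iff (hp : WeaklyConvex (fun i : P => (i : ℂ))) (π : Finpartition P) :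
    blockRel π ∈ NCOn (fun i j k : P => cross i j k = 0) Finset.univ ↔ IsNoncrossing π := by
  have hconv : ∀ i j : P, blockRel π i j → (j : ℂ) ∈ Conv (π.part i) := fun i j h =>
    subset_convexHull ℝ _ (blockRel_iff_mem.1 h)
  constructor
  · rintro ⟨-, h2, h3⟩ A hA B hB hAB
    have hpre : ∀ C ∈ π.parts, (fun i : P => (i : ℂ)) '' {i : P | (i : ℂ) ∈ C} = C := by
      intro C hC
      ext z
      exact ⟨by rintro ⟨i, hi, rfl⟩; exact hi, fun hz => ⟨⟨z, π.subset hC hz⟩, hz, rfl⟩⟩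
    have hne : ∀ C ∈ π.parts, {i : P | (i : ℂ) ∈ C}.Nonempty := by
      intro C hC
      obtain ⟨z, hz⟩ := π.nonempty_of_mem_parts hC
      exact ⟨⟨z, π.subset hC hz⟩, hz⟩
    have hrel : ∀ C ∈ π.parts, ∀ i j : P, (i : ℂ) ∈ C → (j : ℂ) ∈ C → blockRel π i j := by
      intro C hC i j hi hj
      rw [blockRel_iff, π.part_eq_of_mem hC hi, π.part_eq_of_mem hC hj]
    have hnrel : ∀ C ∈ π.parts, ∀ D ∈ π.parts, C ≠ D → ∀ i j : P, (i : ℂ) ∈ C → (j : ℂ) ∈ D →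
        ¬ blockRel π i j := by
      intro C hC D hD hCD i j hi hj h
      rw [blockRel_iff, π.part_eq_of_mem hC hi, π.part_eq_of_mem hD hj] at h
      exact hCD h
    have := hp.disjoint_convexHull Subtype.val_injective (A := {i : P | (i : ℂ) ∈ A})
      (B := {i : P | (i : ℂ) ∈ B}) (toFinite _) (toFinite _) (hne A hA) (hne B hB) ?_ ?_ ?_ ?_ ?_
    · rwa [hpre A hA, hpre B hB] at this
    · rw [Set.disjoint_left]
      exact fun i hi hi' => hAB (π.eq_of_mem_parts hA hB hi hi')
    · exact fun a ha b hb c hc d hd hab hbc hcd => hnrel A hA B hB hAB a b ha hb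
        (h2 a b c d hab hbc hcd (hrel A hA a c ha hc) (hrel B hB b d hb hd))
    · exact fun a ha b hb c hc d hd hab hbc hcd => hnrel B hB A hA hAB.symm a b ha hb
        (h2 a b c d hab hbc hcd (hrel B hB a c ha hc) (hrel A hA b d hb hd))
    · exact fun a ha b hb c hc hab hbc h0 => hnrel A hA B hB hAB a b ha hb
        (h3 a b c (Finset.mem_univ _) hab hbc h0 (hrel A hA a c ha hc))
    · exact fun a ha b hb c hc hab hbc h0 => hnrel B hB A hA hAB.symm a b ha hb
        (h3 a b c (Finset.mem_univ _) hab hbc h0 (hrel B hB a c ha hc))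
  · intro h
    have hmeet : ∀ (i j : P) (z : ℂ), z ∈ Conv (π.part i) → z ∈ Conv (π.part j) →
        blockRel π i j := by
      intro i j z hi hj
      by_contra hne
      exact Set.disjoint_left.1 (h (π.part_mem.2 i.2) (π.part_mem.2 j.2) hne) hi hj
    have hseg : ∀ i j : P, blockRel π i j → segment ℝ (i : ℂ) j ⊆ Conv (π.part i) := fun i j hij =>
      (convex_convexHull ℝ _).segment_subset (hconv i i (Setoid.refl' _ _)) (hconv i j hij)
    refine ⟨fun a b _ => Or.inr ⟨Finset.mem_univ _, Finset.mem_univ _⟩, ?_, ?_⟩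
    · intro a b c d hab hbc hcd hac hbd
      obtain ⟨z, hz, hz'⟩ := hp.segment_inter hab hbc hcd
      exact hmeet a b z (hseg a c hac hz) (hseg b d hbd hz')
    · intro a b c _ hab hbc h0 hac
      exact hmeet a b b
        (hseg a c hac (openSegment_subset_segment ℝ _ _ (hp.mem_openSegment hab hbc h0)))
        (hconv b b (Setoid.refl' _ _))

lemma hasSymmChains_NC (hp : WeaklyConvex (fun i : P => (i : ℂ))) (hP : P.Nonempty) :
    HasSymmChains rk (P.card - 1) (univ : Set (NC P)) := by
  let Φ : NC P → Setoid P := fun π => blockRel π.1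
  have hΦ : ∀ s ∈ NCOn (fun i j k : P => cross i j k = 0) Finset.univ, ∃ π, Φ π = s := by
    intro s hs
    obtain ⟨π, rfl⟩ := exists_blockRel_eq s
    exact ⟨⟨π, (blockRel_mem_NCOn_iff hp π).1 hs⟩, rfl⟩
  have hle : ∀ π σ : NC P, Φ π ≤ Φ σ ↔ π ≤ σ := fun π σ => blockRel_le_iff
  obtain ⟨x, hx⟩ := hP
  have : Nonempty P := ⟨⟨x, hx⟩⟩
  have hNC := hasSymmChains_NCOn (T := fun i j k : P => cross i j k = 0)
    (fun i i' j k' k hi hij hjk hk h => hp.cross_eq_zero Subtype.val_injective hi hij hjk hk h)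
    Finset.univ Finset.univ_nonempty
  rw [Finset.card_univ, Fintype.card_coe] at hNC
  have : Nonempty (NC P) := by
    obtain ⟨π, -⟩ := hΦ ⊥ ⟨fun a b h => Or.inl h,
      fun a b c d hab hbc _ h => absurd h (hab.trans hbc).ne,
      fun a b c _ hab hbc _ h => absurd h (hab.trans hbc).ne⟩
    exact ⟨π⟩
  have hinv : ∀ s ∈ NCOn (fun i j k : P => cross i j k = 0) Finset.univ,
      Φ (Function.invFun Φ s) = s := fun s hs => Function.invFun_eq (hΦ s hs)
  convert hNC.image (rY := rk) (Function.invFun Φ) ?_ ?_ ?_ using 1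
  · refine (Set.eq_univ_of_forall fun π => ?_).symm
    have hmem := (blockRel_mem_NCOn_iff hp π.1).2 π.2
    have heq := hinv _ hmem
    exact ⟨Φ π, hmem, le_antisymm ((hle _ _).1 heq.le) ((hle _ _).1 heq.ge)⟩
  · intro s hs
    rw [rk_eq_setoidRank]
    exact congrArg setoidRank (hinv s hs)
  · intro s hs s' hs' h
    rw [lt_iff_le_not_ge, ← hle, ← hle, hinv s hs, hinv s' hs']
    exact lt_iff_le_not_ge.1 h
  · intro s hs s' hs' h
    rw [← hinv s hs, h, hinv s' hs']

lemma rk_strictMono : StrictMono (rk (P := P)) := by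
  intro π σ h
  rw [rk_eq_setoidRank, rk_eq_setoidRank]
  refine setoidRank_strictMono (lt_iff_le_not_ge.2 ⟨blockRel_le_iff.2 h.le, fun h' => ?_⟩)
  exact h.not_ge (blockRel_le_iff.1 h')

lemma hasSymmetricChainDecomposition_of_weaklyConvex (hp : WeaklyConvex (fun i : P => (i : ℂ)))
    (hP : P.Nonempty) : HasSymmetricChainDecomposition P := by
  obtain ⟨C, hC, hd, hu⟩ := hasSymmChains_NC hp hP
  refine ⟨C, ⟨fun h => (hC _ h).nonempty.ne_empty rfl, fun π => ?_⟩,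
    fun c hc => ⟨(hC c hc).isSaturatedChain rk_strictMono, (hC c hc).isCentered⟩⟩
  obtain ⟨c, hc, hπ⟩ : π ∈ ⋃₀ C := hu ▸ mem_univ π
  refine ⟨c, ⟨hc, hπ⟩, ?_⟩
  rintro c' ⟨hc', hπ'⟩
  by_contra hne
  exact Set.disjoint_left.1 (hd hc' hc hne) hπ' hπ

end Partitions

end HullConfig

theorem theorem2p5 (P : Finset ℂ) (hP : HullConfig.IsHullConfiguration P)
    (hblank : HullConfig.IsOneDimensional P ∨ HullConfig.HasBlankSide P) :
    HullConfig.HasSymmetricChainDecomposition P := by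
  by_cases hone : HullConfig.IsOneDimensional P
  · obtain ⟨_, hp⟩ := HullConfig.exists_order_of_isOneDimensional hone
    exact HullConfig.hasSymmetricChainDecomposition_of_weaklyConvex hp hone.nonempty
  · obtain ⟨x, hx, y, hy, hxy, hside⟩ :=
      HullConfig.exists_oriented_side (hblank.resolve_left hone)
    obtain ⟨_, hp⟩ :=
      HullConfig.exists_order_of_blank_side hx hy hxy hside (hP.resolve_left hone)
    exact HullConfig.hasSymmetricChainDecomposition_of_weaklyConvex hp ⟨x, hx⟩
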